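/- Let $G$ be a finite simple undirected graph with vertex set $\{0,\dots,n-1\}$ and let $\tau : V(G)\to\mathbb{N}$ be a threshold function. For $S\subseteq V(G)$ put $\mathcal{A}[S,0]=S$ and $\mathcal{A}[S,i]=\mathcal{A}[S,i-1]\cup\{u : |N(u)\cap\mathcal{A}[S,i-1]|\ge\tau(u)\}$ for $i\ge 1$, where $N(u)$ is the set of neighbours of $u$. $S$ is a target set if $\bigcup_{i\ge 0}\mathcal{A}[S,i]=V(G)$, and it is optimal if no target set has fewer elements. A vertex cover is a set of vertices that meets every edge; let $t$ be the size of a minimum vertex cover of $G$. Theorem. An optimal target set of $G$ can be computed in time $2^{O(t\log t)}\,n^{O(1)}$. That is, there are a single program for a unit-cost random access machine (with registers and indirectly addressed arrays of natural numbers, and with addition and truncated subtraction as its only arithmetic) and constants $C,c,d\in\mathbb{N}$ such that for all $n$, $G$ and $\tau$ as above, the program, given $n$, the adjacency matrix of $G$ and the list of the values of $\tau$ (but not $t$), halts after at most $C\cdot 2^{c\,t\log_2 t}\cdot (n+1)^{d}$ steps (where $0\log_2 0=0$) and its output is an optimal target set of $G$. -/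

import Mathlib

/-! ### Diffusion in a graph with thresholds, and target sets -/

namespace TargetSetSelection

section Diffusion

variable {V : Type*} [Fintype V] [DecidableEq V]

/-- The vertices that are active on or before time step `i` when the diffusion starts from the
seed set `S`: an inactive vertex `u` becomes active as soon as at least `τ u` of its neighbours
were active in the previous step. -/
def activated (G : SimpleGraph V) [DecidableRel G.Adj] (τ : V → ℕ) (S : Finset V) : ℕ → Finset V
  | 0 => S
  | i + 1 => activated G τ S i ∪
      Finset.univ.filter (fun u => τ u ≤ (G.neighborFinset u ∩ activated G τ S i).card)

/-- The set of all vertices that are eventually activated from the seed set `S`. -/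
def influence (G : SimpleGraph V) [DecidableRel G.Adj] (τ : V → ℕ) (S : Finset V) : Set V :=
  ⋃ i : ℕ, (activated G τ S i : Set V)

/-- `S` is a target set: the diffusion from `S` activates every vertex. -/
def IsTargetSet (G : SimpleGraph V) [DecidableRel G.Adj] (τ : V → ℕ) (S : Finset V) : Prop :=
  influence G τ S = Set.univ

/-- `S` is an optimal target set: a target set of minimum cardinality. -/
def IsOptimalTargetSet (G : SimpleGraph V) [DecidableRel G.Adj] (τ : V → ℕ) (S : Finset V) :
    Prop :=
  IsTargetSet G τ S ∧ ∀ S' : Finset V, IsTargetSet G τ S' → S.card ≤ S'.card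

end Diffusion

end TargetSetSelection

/-! ### Random access machines

Structured programs for a random access machine whose memory consists of registers and of arrays
with indirect addressing (a program is a finite text, so it mentions only finitely many registers
and arrays).  The only arithmetic is addition and truncated subtraction, at unit cost; there is no
multiplication, so running times agree with those of Turing machines up to a polynomial. -/

namespace RAM

/-- A memory content: `reg x` is the value of register `x`, and `arr a i` is the content of cell
`i` of array `a`. -/
structure State where
  reg : ℕ → ℕ
  arr : ℕ → ℕ → ℕ

/-- Arithmetic expressions. -/
inductive Expr where
  | const (k : ℕ)
  | reg (x : ℕ)
  | read (a : ℕ) (i : Expr)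
  | add (e f : Expr)
  | sub (e f : Expr)

/-- The value of an expression (subtraction is truncated at `0`). -/
def Expr.eval (s : State) : Expr → ℕ
  | .const k => k
  | .reg x => s.reg x
  | .read a i => s.arr a (i.eval s)
  | .add e f => e.eval s + f.eval s
  | .sub e f => e.eval s - f.eval s

/-- The number of steps needed to evaluate an expression: one for each node. -/
def Expr.cost : Expr → ℕ
  | .const _ => 1
  | .reg _ => 1
  | .read _ i => i.cost + 1
  | .add e f => e.cost + f.cost + 1
  | .sub e f => e.cost + f.cost + 1

/-- Programs.  The test of `ite` and `loop` succeeds when the value of `e` is not `0`. -/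
inductive Prog where
  | skip
  | set (x : ℕ) (e : Expr)
  | write (a : ℕ) (i e : Expr)
  | seq (p q : Prog)
  | ite (e : Expr) (p q : Prog)
  | loop (e : Expr) (p : Prog)

/-- Assigning a value to a register. -/
def State.setReg (s : State) (x v : ℕ) : State :=
  { s with reg := Function.update s.reg x v }

/-- Assigning a value to an array cell. -/
def State.setArr (s : State) (a i v : ℕ) : State :=
  { s with arr := Function.update s.arr a (Function.update (s.arr a) i v) }

/-- `Runs p s k s'`: program `p`, started in memory `s`, halts after exactly `k` steps with
memory `s'`. -/
inductive Runs : Prog → State → ℕ → State → Prop where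
  | skip (s : State) : Runs .skip s 1 s
  | set (x : ℕ) (e : Expr) (s : State) :
      Runs (.set x e) s (e.cost + 1) (s.setReg x (e.eval s))
  | write (a : ℕ) (i e : Expr) (s : State) :
      Runs (.write a i e) s (i.cost + e.cost + 1) (s.setArr a (i.eval s) (e.eval s))
  | seq {p q : Prog} {s s' s'' : State} {k l : ℕ} :
      Runs p s k s' → Runs q s' l s'' → Runs (.seq p q) s (k + l) s''
  | iteTrue {e : Expr} {p q : Prog} {s s' : State} {k : ℕ} :
      e.eval s ≠ 0 → Runs p s k s' → Runs (.ite e p q) s (e.cost + 1 + k) s'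
  | iteFalse {e : Expr} {p q : Prog} {s s' : State} {k : ℕ} :
      e.eval s = 0 → Runs q s k s' → Runs (.ite e p q) s (e.cost + 1 + k) s'
  | loopDone {e : Expr} {p : Prog} {s : State} :
      e.eval s = 0 → Runs (.loop e p) s (e.cost + 1) s
  | loopStep {e : Expr} {p : Prog} {s s' s'' : State} {k l : ℕ} :
      e.eval s ≠ 0 → Runs p s k s' → Runs (.loop e p) s' l s'' →
      Runs (.loop e p) s (e.cost + 1 + k + l) s''

/-- Execution is deterministic: the final memory and the number of steps of a halting run are
determined by the program and the initial memory. -/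
theorem Runs.unique {p : Prog} {s s₁ s₂ : State} {k₁ k₂ : ℕ} (h₁ : Runs p s k₁ s₁)
    (h₂ : Runs p s k₂ s₂) : k₁ = k₂ ∧ s₁ = s₂ := by
  induction h₁ generalizing k₂ s₂ with
  | skip s => cases h₂; exact ⟨rfl, rfl⟩
  | set x e s => cases h₂; exact ⟨rfl, rfl⟩
  | write a i e s => cases h₂; exact ⟨rfl, rfl⟩
  | seq _ _ ih ih' =>
    cases h₂ with
    | seq a b =>
      obtain ⟨rfl, rfl⟩ := ih a
      obtain ⟨rfl, rfl⟩ := ih' b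
      exact ⟨rfl, rfl⟩
  | iteTrue h _ ih =>
    cases h₂ with
    | iteTrue _ a => obtain ⟨rfl, rfl⟩ := ih a; exact ⟨rfl, rfl⟩
    | iteFalse h' _ => exact absurd h' h
  | iteFalse h _ ih =>
    cases h₂ with
    | iteTrue h' _ => exact absurd h h'
    | iteFalse _ a => obtain ⟨rfl, rfl⟩ := ih a; exact ⟨rfl, rfl⟩
  | loopDone h =>
    cases h₂ with
    | loopDone _ => exact ⟨rfl, rfl⟩
    | loopStep h' _ _ => exact absurd h h'
  | loopStep h _ _ ih ih' =>
    cases h₂ with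
    | loopDone h' => exact absurd h' h
    | loopStep _ a b =>
      obtain ⟨rfl, rfl⟩ := ih a
      obtain ⟨rfl, rfl⟩ := ih' b
      exact ⟨rfl, rfl⟩

end RAM

namespace TargetSetSelection

/-- The initial memory for the instance `(G, τ)` on the vertices `0, …, n - 1`: register `0` holds
`n`, array `0` holds the adjacency matrix of `G` row by row (the entry for `(u, v)` is in cell
`u * n + v`), array `1` holds the thresholds, and everything else is `0`. -/
def inputState {n : ℕ} (G : SimpleGraph (Fin n)) [DecidableRel G.Adj] (τ : Fin n → ℕ) :
    RAM.State where
  reg x := if x = 0 then n else 0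
  arr a i :=
    if a = 0 then
      if ∃ u v : Fin n, i = u.val * n + v.val ∧ G.Adj u v then 1 else 0
    else if a = 1 then
      if h : i < n then τ ⟨i, h⟩ else 0
    else 0

/-- The set of vertices that a final memory describes: those whose cell in array `2` is not `0`. -/
def outputSet (n : ℕ) (s : RAM.State) : Finset (Fin n) :=
  Finset.univ.filter (fun v => s.arr 2 v.val ≠ 0)

end TargetSetSelection

/-! ### Bounded programs and their compilation to random access machines -/

namespace RAM

/-- The least `i < m` that satisfies `p`, or `m` if there is none. -/
def boundedFind (p : ℕ → Prop) [DecidablePred p] : ℕ → ℕ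
  | 0 => 0
  | m + 1 =>
    if boundedFind p m < m then boundedFind p m else if p m then m else m + 1

theorem boundedFind_spec (p : ℕ → Prop) [DecidablePred p] (m : ℕ) :
    boundedFind p m ≤ m ∧ (∀ i < boundedFind p m, ¬ p i) ∧
      (boundedFind p m < m → p (boundedFind p m)) := by
  induction m with
  | zero => simp [boundedFind]
  | succ m ih =>
    obtain ⟨h1, h2, h3⟩ := ih
    rw [boundedFind]
    split_ifs with h h'
    · exact ⟨by omega, h2, fun _ => h3 h⟩
    · have : boundedFind p m = m := by omega
      rw [this] at h2
      exact ⟨by omega, h2, fun _ => h'⟩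
    · have : boundedFind p m = m := by omega
      rw [this] at h2
      refine ⟨le_rfl, fun i hi => ?_, fun h => absurd h (lt_irrefl _)⟩
      rcases Nat.lt_succ_iff_lt_or_eq.mp hi with hi | rfl
      · exact h2 i hi
      · exact h'

/-- Expressions with operations whose running time is controlled by a global bound `N`: sums and
searches range over the numbers below `N`. -/
inductive BExpr where
  | const (k : ℕ)
  | var (x : ℕ)
  | read (a : ℕ) (i : BExpr)
  | add (e f : BExpr)
  | sub (e f : BExpr)
  | mul (e f : BExpr)
  | div (e f : BExpr)
  | ite (c e f : BExpr)
  | letv (x : ℕ) (e f : BExpr)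
  | sum (x : ℕ) (e : BExpr)
  | find (x : ℕ) (e : BExpr)

namespace BExpr

/-- The value of a bounded expression for the bound `N`, the arrays `A` and the variables `ρ`. -/
def eval (N : ℕ) (A : ℕ → ℕ → ℕ) : BExpr → (ℕ → ℕ) → ℕ
  | const k, _ => k
  | var x, ρ => ρ x
  | read a i, ρ => A a (i.eval N A ρ)
  | add e f, ρ => e.eval N A ρ + f.eval N A ρ
  | sub e f, ρ => e.eval N A ρ - f.eval N A ρ
  | mul e f, ρ => ∑ i ∈ Finset.range N, if i < e.eval N A ρ then f.eval N A ρ else 0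
  | div e f, ρ =>
    ∑ i ∈ Finset.range N, if (i + 1) * f.eval N A ρ ≤ e.eval N A ρ then 1 else 0
  | ite c e f, ρ => if c.eval N A ρ ≠ 0 then e.eval N A ρ else f.eval N A ρ
  | letv x e f, ρ => f.eval N A (Function.update ρ x (e.eval N A ρ))
  | sum x e, ρ => ∑ i ∈ Finset.range N, e.eval N A (Function.update ρ x i)
  | find x e, ρ => boundedFind (fun i => e.eval N A (Function.update ρ x i) ≠ 0) N

/-- The program that puts the value of an expression into register `2 * r + 1`. Variable `x` lives
in register `2 * x`, register `1` holds the global bound, and the registers `2 * q + 1` with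
`r ≤ q` are used as scratch space. -/
def compile : BExpr → ℕ → Prog
  | const k, r => .set (2 * r + 1) (.const k)
  | var x, r => .set (2 * r + 1) (.reg (2 * x))
  | read a i, r => .seq (i.compile r) (.set (2 * r + 1) (.read a (.reg (2 * r + 1))))
  | add e f, r => .seq (e.compile r) (.seq (f.compile (r + 1))
      (.set (2 * r + 1) (.add (.reg (2 * r + 1)) (.reg (2 * r + 3)))))
  | sub e f, r => .seq (e.compile r) (.seq (f.compile (r + 1))
      (.set (2 * r + 1) (.sub (.reg (2 * r + 1)) (.reg (2 * r + 3)))))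
  | mul e f, r => .seq (e.compile r) (.seq (f.compile (r + 1))
      (.seq (.set (2 * r + 5) (.const 0)) (.seq (.set (2 * r + 7) (.const 0))
      (.seq
        (.loop (.sub (.reg 1) (.reg (2 * r + 5)))
          (.seq
            (.ite (.sub (.reg (2 * r + 1)) (.reg (2 * r + 5)))
              (.set (2 * r + 7) (.add (.reg (2 * r + 7)) (.reg (2 * r + 3)))) .skip)
            (.set (2 * r + 5) (.add (.reg (2 * r + 5)) (.const 1)))))
        (.set (2 * r + 1) (.reg (2 * r + 7)))))))
  | div e f, r => .seq (e.compile r) (.seq (f.compile (r + 1))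
      (.seq (.set (2 * r + 5) (.const 0)) (.seq (.set (2 * r + 7) (.const 0))
      (.seq
        (.loop (.sub (.reg 1) (.reg (2 * r + 5)))
          (.seq
            (.ite (.sub (.add (.reg (2 * r + 1)) (.const 1)) (.reg (2 * r + 3)))
              (.set (2 * r + 7) (.add (.reg (2 * r + 7)) (.const 1))) .skip)
            (.seq (.set (2 * r + 1) (.sub (.reg (2 * r + 1)) (.reg (2 * r + 3))))
              (.set (2 * r + 5) (.add (.reg (2 * r + 5)) (.const 1))))))
        (.set (2 * r + 1) (.reg (2 * r + 7)))))))
  | ite c e f, r => .seq (c.compile r) (.ite (.reg (2 * r + 1)) (e.compile r) (f.compile r))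
  | letv x e f, r => .seq (e.compile (r + 1)) (.seq (.set (2 * r + 1) (.reg (2 * x)))
      (.seq (.set (2 * x) (.reg (2 * r + 3))) (.seq (f.compile (r + 1))
      (.seq (.set (2 * x) (.reg (2 * r + 1))) (.set (2 * r + 1) (.reg (2 * r + 3)))))))
  | sum x e, r => .seq (.set (2 * r + 1) (.reg (2 * x))) (.seq (.set (2 * r + 3) (.const 0))
      (.seq (.set (2 * x) (.const 0)) (.seq
        (.loop (.sub (.reg 1) (.reg (2 * x)))
          (.seq (e.compile (r + 2))
            (.seq (.set (2 * r + 3) (.add (.reg (2 * r + 3)) (.reg (2 * r + 5))))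
              (.set (2 * x) (.add (.reg (2 * x)) (.const 1))))))
        (.seq (.set (2 * x) (.reg (2 * r + 1))) (.set (2 * r + 1) (.reg (2 * r + 3)))))))
  | find x e, r => .seq (.set (2 * r + 1) (.reg (2 * x))) (.seq (.set (2 * r + 3) (.const 0))
      (.seq (.set (2 * x) (.const 0)) (.seq
        (.loop (.sub (.reg 1) (.reg (2 * x)))
          (.seq
            (.ite (.sub (.reg (2 * x)) (.reg (2 * r + 3))) .skip
              (.seq (e.compile (r + 2))
                (.ite (.reg (2 * r + 5)) .skip
                  (.set (2 * r + 3) (.add (.reg (2 * r + 3)) (.const 1))))))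
            (.set (2 * x) (.add (.reg (2 * x)) (.const 1)))))
        (.seq (.set (2 * x) (.reg (2 * r + 1))) (.set (2 * r + 1) (.reg (2 * r + 3)))))))

end BExpr

/-! ### Cost estimates and correctness of compiled expressions. -/

@[simp] theorem State.setReg_reg (s : State) (x v y : ℕ) :
    (s.setReg x v).reg y = if y = x then v else s.reg y := by
  simp [State.setReg, Function.update_apply]

@[simp] theorem State.setReg_arr (s : State) (x v : ℕ) : (s.setReg x v).arr = s.arr := rfl

@[simp] theorem State.setArr_reg (s : State) (a i v : ℕ) : (s.setArr a i v).reg = s.reg := rfl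

/-- The values of the variables of bounded expressions. -/
def State.vars (s : State) (x : ℕ) : ℕ := s.reg (2 * x)

/-- Times are bounded by pure powers of some `P ≥ 2`: the factor `2` of a sum costs one more
exponent, and `cost_const` moves constants into the exponent, so no leading coefficients are
tracked. -/
theorem cost_add {P a b d e : ℕ} (hP : 2 ≤ P) (ha : a ≤ P ^ d) (hb : b ≤ P ^ e) :
    a + b ≤ P ^ (d + e + 1) := by
  have h1 : 1 ≤ P ^ d := Nat.one_le_pow _ _ (by omega)
  have h2 : 1 ≤ P ^ e := Nat.one_le_pow _ _ (by omega)
  have h3 : P ^ d * P ^ e * 2 ≤ P ^ d * P ^ e * P := Nat.mul_le_mul_left _ hP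
  rw [pow_succ, pow_add]
  nlinarith

theorem cost_const {P : ℕ} (hP : 2 ≤ P) (c : ℕ) : c ≤ P ^ c :=
  (Nat.lt_two_pow_self.le).trans (Nat.pow_le_pow_left hP c)

/-- The invariant carries the round number, and the test tells whether this number is still below
`N`; induction on the number of remaining rounds. -/
theorem exists_runs_loop {e : Expr} {p : Prog} {N K : ℕ} {Inv : ℕ → State → Prop}
    (hcond : ∀ i s, i ≤ N → Inv i s → (e.eval s ≠ 0 ↔ i < N))
    (hstep : ∀ i s, i < N → Inv i s → ∃ k s', Runs p s k s' ∧ k ≤ K ∧ Inv (i + 1) s')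
    {s : State} (h0 : Inv 0 s) :
    ∃ k s', Runs (.loop e p) s k s' ∧ k ≤ (N + 1) * (K + (e.cost + 1)) ∧ Inv N s' := by
  have key : ∀ m i s, i + m = N → Inv i s →
      ∃ k s', Runs (.loop e p) s k s' ∧ k ≤ (m + 1) * (K + (e.cost + 1)) ∧ Inv N s' := by
    intro m
    induction m with
    | zero =>
      intro i s hi h
      obtain rfl : i = N := by omega
      refine ⟨_, _, .loopDone ?_, by omega, h⟩
      by_contra h'
      exact lt_irrefl _ ((hcond i s le_rfl h).mp h')
    | succ m ih =>
      intro i s hi h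
      obtain ⟨k, s', hr, hk, h'⟩ := hstep i s (by omega) h
      obtain ⟨l, s'', hr', hl, h''⟩ := ih (i + 1) s' (by omega) h'
      refine ⟨_, _, .loopStep ((hcond i s (by omega) h).mpr (by omega)) hr hr', ?_, h''⟩
      rw [Nat.succ_mul (m + 1)]
      omega
  exact key N 0 s (by omega) h0

theorem loop_cost {N K d c : ℕ} (hK : K ≤ (N + 2) ^ d) :
    (N + 1) * (K + c) ≤ (N + 2) ^ (d + c + 2) := by
  have h := cost_add (by omega) hK (cost_const (show 2 ≤ N + 2 by omega) c)
  calc (N + 1) * (K + c) ≤ (N + 2) * (N + 2) ^ (d + c + 1) := Nat.mul_le_mul (by omega) h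
    _ = _ := by ring

namespace BExpr

/-- The program `p` puts the value of `e` into register `2 * r + 1` in polynomial time and leaves
the arrays, the variables and the lower registers as they are. -/
def Computes (p : Prog) (e : BExpr) (r d : ℕ) : Prop :=
  ∀ s : State, ∃ k s', Runs p s k s' ∧ k ≤ (s.reg 1 + 2) ^ d ∧ s'.arr = s.arr ∧
    (∀ y, (y % 2 = 0 ∨ y < 2 * r + 1) → s'.reg y = s.reg y) ∧
    s'.reg (2 * r + 1) = e.eval (s.reg 1) s.arr s.vars

/-- The common frame of the binary operations: the second operand is evaluated one slot higher,
which keeps the value of the first one intact. -/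
theorem Computes.bin {e f g : BExpr} {r d₁ d₂ d₃ : ℕ} {pe pf pg : Prog}
    (he : Computes pe e r d₁) (hf : Computes pf f (r + 1) d₂) (hr : 1 ≤ r)
    (hg : ∀ s : State, ∃ k s', Runs pg s k s' ∧ k ≤ (s.reg 1 + 2) ^ d₃ ∧ s'.arr = s.arr ∧
      (∀ y, (y % 2 = 0 ∨ y < 2 * r + 1) → s'.reg y = s.reg y) ∧
      ∀ N A ρ, N = s.reg 1 → s.reg (2 * r + 1) = e.eval N A ρ →
        s.reg (2 * r + 3) = f.eval N A ρ → s'.reg (2 * r + 1) = g.eval N A ρ) :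
    Computes (.seq pe (.seq pf pg)) g r (d₁ + (d₂ + d₃ + 1) + 1) := by
  intro s
  obtain ⟨k, s1, h1, hk, ha, hp, hv⟩ := he s
  obtain ⟨k', s2, h2, hk', ha', hp', hv'⟩ := hf s1
  obtain ⟨k'', s3, h3, hk'', ha'', hp'', hv''⟩ := hg s2
  have e1 : s1.reg 1 = s.reg 1 := hp 1 (by omega)
  have e2 : s2.reg 1 = s.reg 1 := (hp' 1 (by omega)).trans e1
  have ev : s1.vars = s.vars := funext fun x => hp _ (by omega)
  refine ⟨_, _, .seq h1 (.seq h2 h3), ?_, by rw [ha'', ha', ha], ?_, ?_⟩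
  · rw [e1] at hk'
    rw [e2] at hk''
    exact cost_add (by omega) hk (cost_add (by omega) hk' hk'')
  · intro y hy
    rw [hp'' y hy, hp' y (by omega), hp y hy]
  · refine hv'' _ _ _ e2.symm ?_ ?_
    · rw [hp' _ (by omega), hv]
    · rw [show 2 * r + 3 = 2 * (r + 1) + 1 by ring, hv', e1, ha, ev]

/-- The degree depends on the expression and the slot only, since every loop makes as many rounds as
register `1` says. The condition `1 ≤ r` protects register `1` from being used as scratch space. -/
theorem exists_computes (e : BExpr) : ∀ r, 1 ≤ r → ∃ d, Computes (e.compile r) e r d := by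
  induction e with
  | const k =>
    refine fun r hr => ⟨2, fun s => ⟨_, _, .set _ _ _, ?_, rfl, ?_, ?_⟩⟩
    · simpa [Expr.cost] using cost_const (show 2 ≤ s.reg 1 + 2 by omega) 2
    · intro y hy
      simp only [State.setReg_reg]
      rw [if_neg (by omega)]
    · simp [Expr.eval, eval]
  | var x =>
    refine fun r hr => ⟨2, fun s => ⟨_, _, .set _ _ _, ?_, rfl, ?_, ?_⟩⟩
    · simpa [Expr.cost] using cost_const (show 2 ≤ s.reg 1 + 2 by omega) 2
    · intro y hy
      simp only [State.setReg_reg]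
      rw [if_neg (by omega)]
    · simp [Expr.eval, eval, State.vars]
  | read a i ih =>
    intro r hr
    obtain ⟨d, h⟩ := ih r hr
    refine ⟨d + 3 + 1, fun s => ?_⟩
    obtain ⟨k, s1, h1, hk, ha, hp, hv⟩ := h s
    refine ⟨_, _, .seq h1 (.set _ _ _), cost_add (by omega) hk ?_, ha, ?_, ?_⟩
    · simpa [Expr.cost] using cost_const (show 2 ≤ s.reg 1 + 2 by omega) 3
    · intro y hy
      simp only [State.setReg_reg]
      rw [if_neg (by omega), hp y hy]
    · simp [Expr.eval, eval, hv, ha]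
  | add e f ihe ihf =>
    intro r hr
    obtain ⟨d₁, he⟩ := ihe r hr
    obtain ⟨d₂, hf⟩ := ihf (r + 1) (by omega)
    refine ⟨_, he.bin (d₃ := 4) hf hr fun s => ⟨_, _, .set _ _ _, ?_, rfl, ?_, ?_⟩⟩
    · simpa [Expr.cost] using cost_const (show 2 ≤ s.reg 1 + 2 by omega) 4
    · intro y hy
      simp only [State.setReg_reg]
      rw [if_neg (by omega)]
    · intro N A ρ _ h1 h2
      simp [Expr.eval, eval, h1, h2]
  | sub e f ihe ihf =>
    intro r hr
    obtain ⟨d₁, he⟩ := ihe r hr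
    obtain ⟨d₂, hf⟩ := ihf (r + 1) (by omega)
    refine ⟨_, he.bin (d₃ := 4) hf hr fun s => ⟨_, _, .set _ _ _, ?_, rfl, ?_, ?_⟩⟩
    · simpa [Expr.cost] using cost_const (show 2 ≤ s.reg 1 + 2 by omega) 4
    · intro y hy
      simp only [State.setReg_reg]
      rw [if_neg (by omega)]
    · intro N A ρ _ h1 h2
      simp [Expr.eval, eval, h1, h2]
  | mul e f ihe ihf =>
    intro r hr
    obtain ⟨d₁, he⟩ := ihe r hr
    obtain ⟨d₂, hf⟩ := ihf (r + 1) (by omega)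
    -- The exponent combines `6` steps for the three assignments outside the loop with the bound
    -- from `loop_cost` for a body of at most `20` steps and a test of `4`.
    refine ⟨_, he.bin (d₃ := 6 + (24 + 2) + 1) hf hr fun s => ?_⟩
    obtain ⟨l, s2, h2, hl, hs2⟩ := exists_runs_loop
      (e := .sub (.reg 1) (.reg (2 * r + 5))) (N := s.reg 1) (K := 20)
      (p := .seq
            (.ite (.sub (.reg (2 * r + 1)) (.reg (2 * r + 5)))
              (.set (2 * r + 7) (.add (.reg (2 * r + 7)) (.reg (2 * r + 3)))) .skip)
            (.set (2 * r + 5) (.add (.reg (2 * r + 5)) (.const 1))))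
      (Inv := fun i t => t.arr = s.arr ∧
        (∀ y, (y % 2 = 0 ∨ y < 2 * r + 5) → t.reg y = s.reg y) ∧ t.reg (2 * r + 5) = i ∧
        t.reg (2 * r + 7) =
          ∑ j ∈ Finset.range i, if j < s.reg (2 * r + 1) then s.reg (2 * r + 3) else 0)
      (s := (s.setReg (2 * r + 5) 0).setReg (2 * r + 7) 0)
      (by
        rintro i t hi ⟨-, hp, hc, -⟩
        simp only [Expr.eval, hc, hp 1 (by omega)]
        omega)
      (by
        rintro i t hi ⟨ha, hp, hc, hs⟩
        by_cases h : i < s.reg (2 * r + 1)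
        · refine ⟨_, _, .seq (.iteTrue ?_ (.set _ _ _)) (.set _ _ _), ?_, ha, ?_, ?_, ?_⟩
          · simp only [Expr.eval, hc, hp (2 * r + 1) (by omega)]
            omega
          · simp [Expr.cost]
          · intro y hy
            simp only [State.setReg_reg]
            rw [if_neg (by omega), if_neg (by omega), hp y hy]
          · simp [Expr.eval, hc]
          · simp [Expr.eval, hs, Finset.sum_range_succ, h, hp (2 * r + 3) (by omega)]
        · refine ⟨_, _, .seq (.iteFalse ?_ (.skip _)) (.set _ _ _), ?_, ha, ?_, ?_, ?_⟩
          · simp only [Expr.eval, hc, hp (2 * r + 1) (by omega)]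
            omega
          · simp [Expr.cost]
          · intro y hy
            simp only [State.setReg_reg]
            rw [if_neg (by omega), hp y hy]
          · simp [Expr.eval, hc]
          · simp [Expr.eval, hs, Finset.sum_range_succ, h])
      ⟨rfl, by
        intro y hy
        simp only [State.setReg_reg]
        rw [if_neg (by omega), if_neg (by omega)], by simp, by simp⟩
    obtain ⟨ha, hp, hc, hs⟩ := hs2
    refine ⟨_, _, .seq (.set _ _ _) (.seq (.set _ _ _) (.seq h2 (.set _ _ _))), ?_, ha, ?_, ?_⟩
    · have := loop_cost (N := s.reg 1) (c := 4)
        (cost_const (show 2 ≤ s.reg 1 + 2 by omega) 20)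
      have := cost_add (by omega) (cost_const (show 2 ≤ s.reg 1 + 2 by omega) 6)
        (hl.trans this)
      refine le_trans ?_ this
      simp [Expr.cost]
      omega
    · intro y hy
      simp only [State.setReg_reg]
      rw [if_neg (by omega), hp y (by omega)]
    · intro N A ρ hN h1 h2
      simp only [State.setReg_reg, if_true, Expr.eval, eval]
      rw [hs, h1, h2, hN]
  | div e f ihe ihf =>
    intro r hr
    obtain ⟨d₁, he⟩ := ihe r hr
    obtain ⟨d₂, hf⟩ := ihf (r + 1) (by omega)
    refine ⟨_, he.bin (d₃ := 6 + (24 + 2) + 1) hf hr fun s => ?_⟩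
    obtain ⟨l, s2, h2, hl, hs2⟩ := exists_runs_loop
      (e := .sub (.reg 1) (.reg (2 * r + 5))) (N := s.reg 1) (K := 20)
      (p := .seq
            (.ite (.sub (.add (.reg (2 * r + 1)) (.const 1)) (.reg (2 * r + 3)))
              (.set (2 * r + 7) (.add (.reg (2 * r + 7)) (.const 1))) .skip)
            (.seq (.set (2 * r + 1) (.sub (.reg (2 * r + 1)) (.reg (2 * r + 3))))
              (.set (2 * r + 5) (.add (.reg (2 * r + 5)) (.const 1)))))
      (Inv := fun i t => t.arr = s.arr ∧
        (∀ y, (y % 2 = 0 ∨ y < 2 * r + 1) → t.reg y = s.reg y) ∧ t.reg (2 * r + 5) = i ∧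
        t.reg (2 * r + 3) = s.reg (2 * r + 3) ∧
        t.reg (2 * r + 1) = s.reg (2 * r + 1) - i * s.reg (2 * r + 3) ∧
        t.reg (2 * r + 7) =
          ∑ j ∈ Finset.range i,
            if (j + 1) * s.reg (2 * r + 3) ≤ s.reg (2 * r + 1) then 1 else 0)
      (s := (s.setReg (2 * r + 5) 0).setReg (2 * r + 7) 0)
      (by
        rintro i t hi ⟨-, hp, hc, -⟩
        simp only [Expr.eval, hc, hp 1 (by omega)]
        omega)
      (by
        rintro i t hi ⟨ha, hp, hc, hb, hd, hs⟩
        have hsub : s.reg (2 * r + 1) - i * s.reg (2 * r + 3) - s.reg (2 * r + 3) =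
            s.reg (2 * r + 1) - (i + 1) * s.reg (2 * r + 3) := by
          rw [Nat.sub_sub]; congr 1; ring
        -- Division is repeated subtraction. Adding `1` turns the test for a nonzero difference into
        -- `≤`; once the truncated remainder is `0`, the test fails for every positive divisor, as
        -- it should.
        have hle : s.reg (2 * r + 1) - i * s.reg (2 * r + 3) + 1 - s.reg (2 * r + 3) ≠ 0 ↔
            (i + 1) * s.reg (2 * r + 3) ≤ s.reg (2 * r + 1) := by
          rw [Nat.add_one_mul i]
          generalize s.reg (2 * r + 3) = b
          generalize s.reg (2 * r + 1) = a
          rcases Nat.eq_zero_or_pos b with rfl | h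
          · simp
          · omega
        by_cases h : (i + 1) * s.reg (2 * r + 3) ≤ s.reg (2 * r + 1)
        · refine ⟨_, _, .seq (.iteTrue ?_ (.set _ _ _)) (.seq (.set _ _ _) (.set _ _ _)), ?_,
            ha, ?_, ?_, ?_, ?_, ?_⟩
          · simp only [Expr.eval, hb, hd]
            exact hle.mpr h
          · simp [Expr.cost]
          · intro y hy
            simp only [State.setReg_reg]
            rw [if_neg (by omega), if_neg (by omega), if_neg (by omega), hp y hy]
          · simp [Expr.eval, hc]
          · simp [hb]
          · simp [Expr.eval, hb, hd, hsub]
          · rw [Finset.sum_range_succ, if_pos h, ← hs]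
            simp [Expr.eval]
        · refine ⟨_, _, .seq (.iteFalse ?_ (.skip _)) (.seq (.set _ _ _) (.set _ _ _)), ?_,
            ha, ?_, ?_, ?_, ?_, ?_⟩
          · simp only [Expr.eval, hb, hd]
            by_contra h'
            exact h (hle.mp h')
          · simp [Expr.cost]
          · intro y hy
            simp only [State.setReg_reg]
            rw [if_neg (by omega), if_neg (by omega), hp y hy]
          · simp [Expr.eval, hc]
          · simp [hb]
          · simp [Expr.eval, hb, hd, hsub]
          · rw [Finset.sum_range_succ, if_neg h, ← hs]
            simp [Expr.eval])
      ⟨rfl, by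
        intro y hy
        simp only [State.setReg_reg]
        rw [if_neg (by omega), if_neg (by omega)], by simp, by simp, by simp, by simp⟩
    obtain ⟨ha, hp, hc, hb, hd, hs⟩ := hs2
    refine ⟨_, _, .seq (.set _ _ _) (.seq (.set _ _ _) (.seq h2 (.set _ _ _))), ?_, ha, ?_, ?_⟩
    · have := loop_cost (N := s.reg 1) (c := 4)
        (cost_const (show 2 ≤ s.reg 1 + 2 by omega) 20)
      have := cost_add (by omega) (cost_const (show 2 ≤ s.reg 1 + 2 by omega) 6)
        (hl.trans this)
      refine le_trans ?_ this
      simp [Expr.cost]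
      omega
    · intro y hy
      simp only [State.setReg_reg]
      rw [if_neg (by omega), hp y (by omega)]
    · intro N A ρ hN h1 h2
      simp only [State.setReg_reg, if_true, Expr.eval, eval]
      rw [hs, h1, h2, hN]
  | ite c e f ihc ihe ihf =>
    intro r hr
    obtain ⟨d₁, hc⟩ := ihc r hr
    obtain ⟨d₂, he⟩ := ihe r hr
    obtain ⟨d₃, hf⟩ := ihf r hr
    refine ⟨d₁ + (2 + (d₂ + d₃) + 1) + 1, fun s => ?_⟩
    obtain ⟨k, s1, h1, hk, ha, hp, hv⟩ := hc s
    have e1 : s1.reg 1 = s.reg 1 := hp 1 (by omega)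
    have ev : s1.vars = s.vars := funext fun x => hp _ (by omega)
    by_cases h : c.eval (s.reg 1) s.arr s.vars = 0
    · obtain ⟨k', s2, h2, hk', ha', hp', hv'⟩ := hf s1
      refine ⟨_, _, .seq h1 (.iteFalse (by simp [Expr.eval, hv, h]) h2), ?_, by rw [ha', ha],
        fun y hy => by rw [hp' y hy, hp y hy], ?_⟩
      · rw [e1] at hk'
        refine cost_add (by omega) hk (cost_add (by omega) (cost_const (by omega) 2) ?_)
        exact hk'.trans (Nat.pow_le_pow_right (by omega) (by omega))
      · rw [hv', e1, ha, ev]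
        simp [eval, h]
    · obtain ⟨k', s2, h2, hk', ha', hp', hv'⟩ := he s1
      refine ⟨_, _, .seq h1 (.iteTrue (by simp [Expr.eval, hv, h]) h2), ?_, by rw [ha', ha],
        fun y hy => by rw [hp' y hy, hp y hy], ?_⟩
      · rw [e1] at hk'
        refine cost_add (by omega) hk (cost_add (by omega) (cost_const (by omega) 2) ?_)
        exact hk'.trans (Nat.pow_le_pow_right (by omega) (by omega))
      · rw [hv', e1, ha, ev]
        simp [eval, h]
  | letv x e f ihe ihf =>
    intro r hr
    obtain ⟨d₁, he⟩ := ihe (r + 1) (by omega)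
    obtain ⟨d₂, hf⟩ := ihf (r + 1) (by omega)
    refine ⟨d₁ + (d₂ + 8 + 1) + 1, fun s => ?_⟩
    obtain ⟨k, s1, h1, hk, ha, hp, hv⟩ := he s
    -- The old value of `x` is parked in register `2 * r + 1`, below the scratch space of `f`, and
    -- is restored at the end.
    obtain ⟨k', s2, h2, hk', ha', hp', hv'⟩ :=
      hf ((s1.setReg (2 * r + 1) (s1.reg (2 * x))).setReg (2 * x) (s1.reg (2 * r + 3)))
    have e1 : s1.reg 1 = s.reg 1 := hp 1 (by omega)
    have h13 : ∀ y, 2 * r + 3 ≠ 2 * y := by omega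
    have h2' : Runs (f.compile (r + 1))
        ((s1.setReg (2 * r + 1) ((Expr.reg (2 * x)).eval s1)).setReg (2 * x)
          ((Expr.reg (2 * r + 3)).eval
            (s1.setReg (2 * r + 1) ((Expr.reg (2 * x)).eval s1)))) k' s2 := by
      convert h2 using 2 <;> simp [Expr.eval]
    refine ⟨_, _, .seq h1 (.seq (.set _ _ _) (.seq (.set _ _ _) (.seq h2' (.seq (.set _ _ _)
      (.set _ _ _))))), ?_, ?_, ?_, ?_⟩
    · have : ((s1.setReg (2 * r + 1) (s1.reg (2 * x))).setReg (2 * x)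
          (s1.reg (2 * r + 3))).reg 1 = s.reg 1 := by
        simp only [State.setReg_reg]
        rw [if_neg (by omega), if_neg (by omega), e1]
      rw [this] at hk'
      have := cost_add (by omega) hk (cost_add (by omega) hk'
        (cost_const (show 2 ≤ s.reg 1 + 2 by omega) 8))
      simp [Expr.cost]
      omega
    · simp [ha', ha]
    · intro y hy
      simp only [State.setReg_reg, Expr.eval]
      rw [if_neg (by omega)]
      split_ifs with hyx
      · rw [hp' _ (by omega)]
        simp only [State.setReg_reg]
        rw [if_neg (by omega), if_true, hyx, hp _ (by omega)]
      · rw [hp' _ (by omega)]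
        simp only [State.setReg_reg]
        rw [if_neg hyx, if_neg (by omega), hp _ (by omega)]
    · have hv3 : s1.reg (2 * r + 3) = e.eval (s.reg 1) s.arr s.vars := hv
      have hv4 : s2.reg (2 * r + 3) = _ := hv'
      simp only [State.setReg_reg, Expr.eval, if_true]
      rw [if_neg (h13 x), hv4]
      simp only [State.setReg_reg, State.setReg_arr, eval]
      rw [if_neg (by omega), if_neg (by omega), e1, ha]
      congr 1
      funext y
      simp only [State.vars, State.setReg_reg, Function.update_apply]
      by_cases hy : y = x
      · simp [hy, hv3]
      · rw [if_neg (by omega), if_neg (by omega), if_neg hy, hp _ (by omega)]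
  | sum x e ih =>
    intro r hr
    obtain ⟨d, he⟩ := ih (r + 2) (by omega)
    refine ⟨10 + (d + 8 + 1 + 4 + 2) + 1, fun s => ?_⟩
    obtain ⟨l, s2, h2, hl, hs2⟩ := exists_runs_loop
      (e := .sub (.reg 1) (.reg (2 * x))) (N := s.reg 1) (K := (s.reg 1 + 2) ^ (d + 8 + 1))
      (p := .seq (e.compile (r + 2))
            (.seq (.set (2 * r + 3) (.add (.reg (2 * r + 3)) (.reg (2 * r + 5))))
              (.set (2 * x) (.add (.reg (2 * x)) (.const 1)))))
      (Inv := fun i t => t.arr = s.arr ∧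
        (∀ y, y ≠ 2 * x → (y % 2 = 0 ∨ y < 2 * r + 1) → t.reg y = s.reg y) ∧
        t.reg (2 * x) = i ∧ t.reg (2 * r + 1) = s.reg (2 * x) ∧
        t.reg (2 * r + 3) =
          ∑ j ∈ Finset.range i, e.eval (s.reg 1) s.arr (Function.update s.vars x j))
      (s := ((s.setReg (2 * r + 1) (s.reg (2 * x))).setReg (2 * r + 3) 0).setReg (2 * x) 0)
      (by
        rintro i t hi ⟨-, hp, hc, -⟩
        simp only [Expr.eval, hc, hp 1 (by omega) (by omega)]
        omega)
      (by
        rintro i t hi ⟨ha, hp, hc, hx, hs⟩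
        obtain ⟨k, t', h1, hk, ha', hp', hv⟩ := he t
        have e1 : t.reg 1 = s.reg 1 := hp 1 (by omega) (by omega)
        have ev : t.vars = Function.update s.vars x i := by
          funext y
          simp only [Function.update_apply, State.vars]
          split_ifs with h
          · rw [h, hc]
          · exact hp _ (by omega) (by omega)
        have hv5 : t'.reg (2 * r + 5) = _ := hv
        refine ⟨_, _, .seq h1 (.seq (.set _ _ _) (.set _ _ _)), ?_, ha'.trans ha, ?_, ?_, ?_,
          ?_⟩
        · rw [e1] at hk
          refine cost_add (by omega) hk (le_trans ?_ (cost_const (by omega) 8))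
          simp [Expr.cost]
        · intro y hy hy'
          simp only [State.setReg_reg]
          rw [if_neg (by omega), if_neg (by omega), hp' y (by omega), hp y hy hy']
        · simp only [State.setReg_reg, Expr.eval, if_true]
          rw [if_neg (by omega), hp' _ (by omega), hc]
        · simp only [State.setReg_reg]
          rw [if_neg (by omega), if_neg (by omega), hp' _ (by omega), hx]
        · simp only [State.setReg_reg, Expr.eval]
          rw [if_neg (by omega), if_true, hp' _ (by omega), hs, hv5, Finset.sum_range_succ,
            e1, ha, ev])
      ⟨rfl, by
        intro y hy hy'
        simp only [State.setReg_reg]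
        rw [if_neg (by omega), if_neg (by omega), if_neg (by omega)], by simp, by
        simp only [State.setReg_reg]
        rw [if_neg (by omega), if_neg (by omega), if_true], by
        simp only [State.setReg_reg]
        rw [if_neg (by omega), if_true]; simp⟩
    obtain ⟨ha, hp, hc, hx, hs⟩ := hs2
    refine ⟨_, _, .seq (.set _ _ _) (.seq (.set _ _ _) (.seq (.set _ _ _) (.seq h2
      (.seq (.set _ _ _) (.set _ _ _))))), ?_, ha, ?_, ?_⟩
    · have := loop_cost (N := s.reg 1) (c := 4)
        (le_refl ((s.reg 1 + 2) ^ (d + 8 + 1)))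
      have := cost_add (by omega) (cost_const (show 2 ≤ s.reg 1 + 2 by omega) 10)
        (hl.trans this)
      refine le_trans ?_ this
      simp [Expr.cost]
      omega
    · intro y hy
      simp only [State.setReg_reg, Expr.eval]
      rw [if_neg (by omega)]
      split_ifs with h
      · rw [hx, h]
      · rw [hp y h hy]
    · simp only [State.setReg_reg, Expr.eval, if_true]
      rw [if_neg (by omega), hs, eval]
  | find x e ih =>
    intro r hr
    obtain ⟨d, he⟩ := ih (r + 2) (by omega)
    refine ⟨10 + (d + 20 + 1 + 4 + 2) + 1, fun s => ?_⟩
    obtain ⟨l, s2, h2, hl, hs2⟩ := exists_runs_loop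
      (e := .sub (.reg 1) (.reg (2 * x))) (N := s.reg 1) (K := (s.reg 1 + 2) ^ (d + 20 + 1))
      (p := .seq
            (.ite (.sub (.reg (2 * x)) (.reg (2 * r + 3))) .skip
              (.seq (e.compile (r + 2))
                (.ite (.reg (2 * r + 5)) .skip
                  (.set (2 * r + 3) (.add (.reg (2 * r + 3)) (.const 1))))))
            (.set (2 * x) (.add (.reg (2 * x)) (.const 1))))
      (Inv := fun i t => t.arr = s.arr ∧
        (∀ y, y ≠ 2 * x → (y % 2 = 0 ∨ y < 2 * r + 1) → t.reg y = s.reg y) ∧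
        t.reg (2 * x) = i ∧ t.reg (2 * r + 1) = s.reg (2 * x) ∧
        t.reg (2 * r + 3) = boundedFind
          (fun j => e.eval (s.reg 1) s.arr (Function.update s.vars x j) ≠ 0) i)
      (s := ((s.setReg (2 * r + 1) (s.reg (2 * x))).setReg (2 * r + 3) 0).setReg (2 * x) 0)
      (by
        rintro i t hi ⟨-, hp, hc, -⟩
        simp only [Expr.eval, hc, hp 1 (by omega) (by omega)]
        omega)
      (by
        rintro i t hi ⟨ha, hp, hc, hx, hs⟩
        obtain ⟨k, t', h1, hk, ha', hp', hv⟩ := he t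
        have e1 : t.reg 1 = s.reg 1 := hp 1 (by omega) (by omega)
        have ev : t.vars = Function.update s.vars x i := by
          funext y
          simp only [Function.update_apply, State.vars]
          split_ifs with h
          · rw [h, hc]
          · exact hp _ (by omega) (by omega)
        have hv5 : t'.reg (2 * r + 5) = _ := hv
        rw [e1, ha, ev] at hv5
        rw [e1] at hk
        have hfind := boundedFind_spec
          (fun j => e.eval (s.reg 1) s.arr (Function.update s.vars x j) ≠ 0) i
        have hK : 20 ≤ (s.reg 1 + 2) ^ 20 := cost_const (by omega) 20
        have hK' : ∀ a b, a ≤ (s.reg 1 + 2) ^ d → b ≤ 20 →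
            a + b ≤ (s.reg 1 + 2) ^ (d + 20 + 1) :=
          fun a b h h' => cost_add (by omega) h (h'.trans hK)
        -- The counter in register `2 * r + 3` advances with the loop index until a witness occurs
        -- and then stays put; lagging behind the index therefore means that the search has
        -- succeeded.
        by_cases hf : boundedFind
          (fun j => e.eval (s.reg 1) s.arr (Function.update s.vars x j) ≠ 0) i < i
        · refine ⟨_, _, .seq (.iteTrue ?_ (.skip _)) (.set _ _ _), ?_, ha, ?_, ?_, ?_, ?_⟩
          · simp only [Expr.eval, hc, hs]
            omega
          · simpa [Expr.cost] using hK' 0 9 (by omega) (by omega)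
          · intro y hy hy'
            simp only [State.setReg_reg]
            rw [if_neg (by omega), hp y hy hy']
          · simp [Expr.eval, hc]
          · simp only [State.setReg_reg]
            rw [if_neg (by omega), hx]
          · simp only [State.setReg_reg]
            rw [if_neg (by omega), hs, boundedFind, if_pos hf]
        · by_cases h0 : e.eval (s.reg 1) s.arr (Function.update s.vars x i) = 0
          · refine ⟨_, _, .seq (.iteFalse ?_ (.seq h1 (.iteFalse ?_ (.set _ _ _))))
              (.set _ _ _), ?_, ha'.trans ha, ?_, ?_, ?_, ?_⟩
            · simp only [Expr.eval, hc, hs]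
              omega
            · simp only [Expr.eval, hv5, h0]
            · refine le_trans ?_ (hK' k 20 hk le_rfl)
              simp [Expr.cost]
              omega
            · intro y hy hy'
              simp only [State.setReg_reg]
              rw [if_neg (by omega), if_neg (by omega), hp' y (by omega), hp y hy hy']
            · simp only [State.setReg_reg, Expr.eval, if_true]
              rw [if_neg (by omega), hp' _ (by omega), hc]
            · simp only [State.setReg_reg]
              rw [if_neg (by omega), if_neg (by omega), hp' _ (by omega), hx]
            · simp only [State.setReg_reg, Expr.eval]
              rw [if_neg (by omega), if_true, hp' _ (by omega), hs, boundedFind, if_neg hf,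
                if_neg (by simp [h0])]
              omega
          · refine ⟨_, _, .seq (.iteFalse ?_ (.seq h1 (.iteTrue ?_ (.skip _))))
              (.set _ _ _), ?_, ha'.trans ha, ?_, ?_, ?_, ?_⟩
            · simp only [Expr.eval, hc, hs]
              omega
            · simp only [Expr.eval, hv5]
              exact h0
            · refine le_trans ?_ (hK' k 20 hk le_rfl)
              simp [Expr.cost]
              omega
            · intro y hy hy'
              simp only [State.setReg_reg]
              rw [if_neg (by omega), hp' y (by omega), hp y hy hy']
            · simp only [State.setReg_reg, Expr.eval, if_true]
              rw [hp' _ (by omega), hc]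
            · simp only [State.setReg_reg]
              rw [if_neg (by omega), hp' _ (by omega), hx]
            · simp only [State.setReg_reg, Expr.eval]
              rw [if_neg (by omega), hp' _ (by omega), hs, boundedFind, if_neg hf,
                if_pos h0]
              omega)
      ⟨rfl, by
        intro y hy hy'
        simp only [State.setReg_reg]
        rw [if_neg (by omega), if_neg (by omega), if_neg (by omega)], by simp, by
        simp only [State.setReg_reg]
        rw [if_neg (by omega), if_neg (by omega), if_true], by
        simp only [State.setReg_reg]
        rw [if_neg (by omega), if_true]; simp [boundedFind]⟩
    obtain ⟨ha, hp, hc, hx, hs⟩ := hs2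
    refine ⟨_, _, .seq (.set _ _ _) (.seq (.set _ _ _) (.seq (.set _ _ _) (.seq h2
      (.seq (.set _ _ _) (.set _ _ _))))), ?_, ha, ?_, ?_⟩
    · have := loop_cost (N := s.reg 1) (c := 4)
        (le_refl ((s.reg 1 + 2) ^ (d + 20 + 1)))
      have := cost_add (by omega) (cost_const (show 2 ≤ s.reg 1 + 2 by omega) 10)
        (hl.trans this)
      refine le_trans ?_ this
      simp [Expr.cost]
      omega
    · intro y hy
      simp only [State.setReg_reg, Expr.eval]
      rw [if_neg (by omega)]
      split_ifs with h
      · rw [hx, h]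
      · rw [hp y h hy]
    · simp only [State.setReg_reg, Expr.eval, if_true]
      rw [if_neg (by omega), hs, eval]

end BExpr

/-- Bounded programs: `set x e` assigns a variable, and `tab a x e` fills the cells
`x = 0, 1, …, N - 1` of array `a`, in this order, with the values of `e`. -/
inductive BProg where
  | set (x : ℕ) (e : BExpr)
  | tab (a x : ℕ) (e : BExpr)
  | seq (p q : BProg)

namespace BProg

/-- The arrays after the first `i` rounds of `tab a x e`. -/
def tabulate (N a x : ℕ) (e : BExpr) (ρ : ℕ → ℕ) (A : ℕ → ℕ → ℕ) : ℕ → ℕ → ℕ → ℕ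
  | 0 => A
  | i + 1 => Function.update (tabulate N a x e ρ A i) a
      (Function.update (tabulate N a x e ρ A i a) i
        (e.eval N (tabulate N a x e ρ A i) (Function.update ρ x i)))

/-- The effect of a bounded program on variables and arrays. -/
def exec (N : ℕ) : BProg → (ℕ → ℕ) × (ℕ → ℕ → ℕ) → (ℕ → ℕ) × (ℕ → ℕ → ℕ)
  | set x e, σ => (Function.update σ.1 x (e.eval N σ.2 σ.1), σ.2)
  | tab a x e, σ => (Function.update σ.1 x N, tabulate N a x e σ.1 σ.2 N)
  | seq p q, σ => q.exec N (p.exec N σ)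

/-- The program for a random access machine that executes a bounded program. -/
def compile : BProg → Prog
  | set x e => .seq (e.compile 1) (.set (2 * x) (.reg 3))
  | tab a x e => .seq (.set (2 * x) (.const 0))
      (.loop (.sub (.reg 1) (.reg (2 * x)))
        (.seq (e.compile 1)
          (.seq (.write a (.reg (2 * x)) (.reg 3))
            (.set (2 * x) (.add (.reg (2 * x)) (.const 1))))))
  | seq p q => .seq p.compile q.compile

/-- Bounded programs run in time polynomial in their bound. -/
theorem exists_runs_compile (p : BProg) : ∃ d, ∀ s : State, ∃ k s', Runs p.compile s k s' ∧
    k ≤ (s.reg 1 + 2) ^ d ∧ s'.reg 1 = s.reg 1 ∧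
    (s'.vars, s'.arr) = p.exec (s.reg 1) (s.vars, s.arr) := by
  induction p with
  | set x e =>
    obtain ⟨d, he⟩ := e.exists_computes 1 le_rfl
    refine ⟨d + 2 + 1, fun s => ?_⟩
    obtain ⟨k, s1, h1, hk, ha, hp, hv⟩ := he s
    refine ⟨_, _, .seq h1 (.set _ _ _), cost_add (by omega) hk ?_, ?_, ?_⟩
    · simpa [Expr.cost] using cost_const (show 2 ≤ s.reg 1 + 2 by omega) 2
    · simp only [State.setReg_reg]
      rw [if_neg (by omega), hp 1 (by omega)]
    · simp only [exec, State.setReg_arr, ha, Prod.mk.injEq, and_true]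
      funext y
      simp only [State.vars, State.setReg_reg, Expr.eval, Function.update_apply]
      by_cases hy : y = x
      · simpa [hy] using hv
      · rw [if_neg (by omega), if_neg hy, hp _ (by omega)]
  | tab a x e =>
    obtain ⟨d, he⟩ := e.exists_computes 1 le_rfl
    refine ⟨10 + (d + 8 + 1 + 4 + 2) + 1, fun s => ?_⟩
    obtain ⟨l, s2, h2, hl, hs2⟩ := exists_runs_loop
      (e := .sub (.reg 1) (.reg (2 * x))) (N := s.reg 1) (K := (s.reg 1 + 2) ^ (d + 8 + 1))
      (p := .seq (e.compile 1)
          (.seq (.write a (.reg (2 * x)) (.reg 3))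
            (.set (2 * x) (.add (.reg (2 * x)) (.const 1)))))
      (Inv := fun i t => t.arr = tabulate (s.reg 1) a x e s.vars s.arr i ∧
        t.reg 1 = s.reg 1 ∧ t.vars = Function.update s.vars x i)
      (s := s.setReg (2 * x) 0)
      (by
        rintro i t hi ⟨-, h1, hv⟩
        have : t.reg (2 * x) = i := by simpa [State.vars] using congrFun hv x
        simp only [Expr.eval, h1, this]
        omega)
      (by
        rintro i t hi ⟨ha, e1, hv⟩
        have hx : t.reg (2 * x) = i := by simpa [State.vars] using congrFun hv x
        obtain ⟨k, t', h1, hk, ha', hp', hv'⟩ := he t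
        refine ⟨_, _, .seq h1 (.seq (.write _ _ _ _) (.set _ _ _)), ?_, ?_, ?_, ?_⟩
        · rw [e1] at hk
          refine cost_add (by omega) hk (le_trans ?_ (cost_const (by omega) 8))
          simp [Expr.cost]
        · have hv3 : t'.reg 3 = _ := hv'
          simp only [State.setReg_arr, State.setArr, Expr.eval, tabulate, ha', ha, hv3, e1, hv]
          rw [hp' _ (by omega), hx]
        · simp only [State.setReg_reg, State.setArr_reg]
          rw [if_neg (by omega), hp' _ (by omega), e1]
        · funext y
          have := congrFun hv y
          simp only [State.vars, State.setReg_reg, State.setArr_reg, Expr.eval,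
            Function.update_apply] at this ⊢
          by_cases hy : y = x
          · rw [if_pos (by omega), if_pos hy, hp' _ (by omega), hx]
          · rw [if_neg (by omega), if_neg hy, hp' _ (by omega), this, if_neg hy])
      ⟨rfl, by rw [State.setReg_reg, if_neg (by omega)], by
        funext y
        simp [State.vars, Function.update_apply]⟩
    obtain ⟨ha, h1, hv⟩ := hs2
    refine ⟨_, _, .seq (.set _ _ _) h2, ?_, h1, ?_⟩
    · have := loop_cost (N := s.reg 1) (c := 4)
        (le_refl ((s.reg 1 + 2) ^ (d + 8 + 1)))
      have := cost_add (by omega) (cost_const (show 2 ≤ s.reg 1 + 2 by omega) 10)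
        (hl.trans this)
      refine le_trans ?_ this
      simp [Expr.cost]
    · rw [hv, ha, exec]
  | seq p q ihp ihq =>
    obtain ⟨d₁, hp⟩ := ihp
    obtain ⟨d₂, hq⟩ := ihq
    refine ⟨d₁ + d₂ + 1, fun s => ?_⟩
    obtain ⟨k, s1, h1, hk, e1, hs⟩ := hp s
    obtain ⟨k', s2, h2, hk', e2, hs'⟩ := hq s1
    refine ⟨_, _, .seq h1 h2, ?_, e2.trans e1, ?_⟩
    · rw [e1] at hk'
      exact cost_add (by omega) hk hk'
    · rw [hs', e1, hs, exec]

/-! ### What a bounded program changes and what it leaves alone. -/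

theorem tabulate_of_ne {N a x : ℕ} {e : BExpr} {ρ : ℕ → ℕ} {A : ℕ → ℕ → ℕ} {b : ℕ}
    (hb : b ≠ a) (i : ℕ) : tabulate N a x e ρ A i b = A b := by
  induction i with
  | zero => rfl
  | succ i ih => rw [tabulate, Function.update_of_ne hb, ih]

theorem tabulate_stable {N a x : ℕ} {e : BExpr} {ρ : ℕ → ℕ} {A : ℕ → ℕ → ℕ} {i j m : ℕ}
    (hj : j < i) (hi : i ≤ m) : tabulate N a x e ρ A m a j = tabulate N a x e ρ A i a j := by
  induction hi with
  | refl => rfl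
  | step h ih =>
    have : i ≤ _ := h
    rw [tabulate, Function.update_self, Function.update_of_ne (by omega), ih]

/-- An entry of a table is the value of its expression in a memory that contains the earlier
entries. -/
theorem exec_tab_rec (N a x : ℕ) (e : BExpr) (σ : (ℕ → ℕ) × (ℕ → ℕ → ℕ)) {i : ℕ} (hi : i < N) :
    ∃ A' : ℕ → ℕ → ℕ, (∀ b, b ≠ a → A' b = σ.2 b) ∧
      (∀ j < i, A' a j = ((tab a x e).exec N σ).2 a j) ∧
      ((tab a x e).exec N σ).2 a i = e.eval N A' (Function.update σ.1 x i) := by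
  refine ⟨tabulate N a x e σ.1 σ.2 i, fun b hb => tabulate_of_ne hb i,
    fun j hj => (tabulate_stable hj (by omega)).symm, ?_⟩
  change tabulate N a x e σ.1 σ.2 N a i = _
  rw [tabulate_stable (Nat.lt_succ_self i) hi, tabulate, Function.update_self,
    Function.update_self]

/-- A table may be computed by recursion on the entries that have already been computed. -/
theorem exec_tab_spec {N a x : ℕ} {e : BExpr} {σ : (ℕ → ℕ) × (ℕ → ℕ → ℕ)} {F : ℕ → ℕ}
    (h : ∀ i < N, ∀ A' : ℕ → ℕ → ℕ, (∀ b, b ≠ a → A' b = σ.2 b) → (∀ j < i, A' a j = F j) →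
      e.eval N A' (Function.update σ.1 x i) = F i) :
    ∀ i < N, ((tab a x e).exec N σ).2 a i = F i := by
  intro i
  induction i using Nat.strong_induction_on with
  | _ i ih =>
    intro hi
    obtain ⟨A', h1, h2, h3⟩ := exec_tab_rec N a x e σ hi
    rw [h3]
    exact h i hi A' h1 fun j hj => (h2 j hj).trans (ih j hj (by omega))

theorem exec_tab_arr {N a x : ℕ} {e : BExpr} {σ : (ℕ → ℕ) × (ℕ → ℕ → ℕ)} {b : ℕ} (hb : b ≠ a) :
    ((tab a x e).exec N σ).2 b = σ.2 b := tabulate_of_ne hb N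

theorem exec_tab_var {N a x : ℕ} {e : BExpr} {σ : (ℕ → ℕ) × (ℕ → ℕ → ℕ)} {y : ℕ} (hy : y ≠ x) :
    ((tab a x e).exec N σ).1 y = σ.1 y := Function.update_of_ne hy _ _

theorem exec_set_arr {N x : ℕ} {e : BExpr} {σ : (ℕ → ℕ) × (ℕ → ℕ → ℕ)} :
    ((set x e).exec N σ).2 = σ.2 := rfl

theorem exec_set_var {N x : ℕ} {e : BExpr} {σ : (ℕ → ℕ) × (ℕ → ℕ → ℕ)} {y : ℕ} (hy : y ≠ x) :
    ((set x e).exec N σ).1 y = σ.1 y := Function.update_of_ne hy _ _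

theorem exec_set_self {N x : ℕ} {e : BExpr} {σ : (ℕ → ℕ) × (ℕ → ℕ → ℕ)} :
    ((set x e).exec N σ).1 x = e.eval N σ.2 σ.1 := Function.update_self _ _ _

end BProg

end RAM

/-! ### Target sets and vertex covers -/

namespace TargetSetSelection

open Finset

section Closed

variable {V : Type*} [Fintype V] [DecidableEq V] {G : SimpleGraph V} [DecidableRel G.Adj]
  {τ : V → ℕ} {S : Finset V}

theorem activated_mono {i j : ℕ} (h : i ≤ j) : activated G τ S i ⊆ activated G τ S j := by
  induction h with
  | refl => exact subset_rfl
  | step _ ih => exact ih.trans subset_union_left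

/-- A target set is a set that has no proper superset that is closed under activation. -/
theorem isTargetSet_iff : IsTargetSet G τ S ↔ ∀ P : Finset V, S ⊆ P →
    (∀ u, τ u ≤ (univ.filter fun v => G.Adj u v ∧ v ∈ P).card → u ∈ P) → ∀ u, u ∈ P := by
  have hN : ∀ u (P : Finset V),
      (univ.filter fun v => G.Adj u v ∧ v ∈ P) = G.neighborFinset u ∩ P := by
    intro u P
    ext v
    simp
  simp only [hN]
  constructor
  · intro h P hS hP u
    have hi : ∀ i, activated G τ S i ⊆ P := by
      intro i
      induction i with
      | zero => exact hS
      | succ i ih =>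
        refine union_subset ih fun u hu => hP u ?_
        simp only [mem_filter, mem_univ, true_and] at hu
        exact hu.trans (card_le_card (inter_subset_inter_left ih))
    have hu : u ∈ influence G τ S := by rw [h]; trivial
    obtain ⟨i, hu⟩ := Set.mem_iUnion.mp hu
    exact hi i hu
  · intro h
    classical
    have hmem : ∀ u, (∃ i, u ∈ activated G τ S i) := by
      intro u
      have := h (univ.filter fun u => ∃ i, u ∈ activated G τ S i)
        (fun v hv => by simpa using ⟨0, hv⟩) ?_ u
      · simpa using this
      · intro u hu
        choose! f hf using fun (v : V) (hv : ∃ i, v ∈ activated G τ S i) => hv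
        -- By finiteness a single stage already contains everything that is ever activated.
        have hsub : (univ.filter fun u => ∃ i, u ∈ activated G τ S i) ⊆
            activated G τ S (univ.sup f) := by
          intro v hv
          exact activated_mono (le_sup (mem_univ v)) (hf v (by simpa using hv))
        simp only [mem_filter, mem_univ, true_and]
        refine ⟨univ.sup f + 1, mem_union_right _ ?_⟩
        simp only [mem_filter, mem_univ, true_and]
        exact hu.trans (card_le_card (inter_subset_inter_left hsub))
    refine Set.eq_univ_of_forall fun u => Set.mem_iUnion.mpr ?_
    simpa using hmem u

/-- Vertices whose threshold exceeds their degree belong to every target set, and may be treated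
as if they were activated spontaneously. -/
theorem isTargetSet_iff_of_forced {T : V → ℕ}
    (hT : ∀ u, T u = if (univ.filter fun v => G.Adj u v).card < τ u then 0 else τ u) :
    IsTargetSet G τ S ↔ (∀ u, (univ.filter fun v => G.Adj u v).card < τ u → u ∈ S) ∧
      IsTargetSet G T S := by
  simp only [isTargetSet_iff]
  have hle : ∀ u (P : Finset V), (univ.filter fun v => G.Adj u v ∧ v ∈ P).card ≤
      (univ.filter fun v => G.Adj u v).card := by
    intro u P
    exact card_le_card (monotone_filter_right _ fun v _ hv => hv.1)
  constructor
  · intro h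
    refine ⟨fun u hu => ?_, fun P hS hP => h P hS fun u hu => hP u ?_⟩
    · by_contra hus
      -- If `u` is not selected, the set of all other vertices is closed, because `u` has too few
      -- neighbours ever to be activated.
      have := h (univ.erase u) (fun v hv => mem_erase.mpr ⟨by rintro rfl; exact hus hv, mem_univ _⟩)
        (fun v hv => mem_erase.mpr ⟨by
          rintro rfl
          exact absurd (hv.trans (hle _ _)) (by omega), mem_univ _⟩) u
      simp at this
    · rw [hT, if_neg (by have := hle u P; omega)]
      exact hu
  · rintro ⟨hF, h⟩ P hS hP
    refine h P hS fun u hu => ?_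
    rw [hT] at hu
    split_ifs at hu with h'
    · exact hS (hF u h')
    · exact hP u hu

/-- A competitor `R` contains the set `F` of forced vertices, and `R \ F` is still a target set for
`T`, under which `F` activates itself. Hence `|S'| ≤ |F| + |S| ≤ |F| + |R \ F| = |R|`. -/
theorem isOptimalTargetSet_of_forced {T : V → ℕ}
    (hT : ∀ u, T u = if (univ.filter fun v => G.Adj u v).card < τ u then 0 else τ u)
    (hS : IsOptimalTargetSet G T S) {S' : Finset V}
    (hS' : ∀ u, u ∈ S' ↔ (univ.filter fun v => G.Adj u v).card < τ u ∨ u ∈ S) :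
    IsOptimalTargetSet G τ S' := by
  constructor
  · refine (isTargetSet_iff_of_forced hT).mpr ⟨fun u hu => (hS' u).mpr (.inl hu), ?_⟩
    rw [isTargetSet_iff]
    exact fun P hP => isTargetSet_iff.mp hS.1 P fun u hu => hP ((hS' u).mpr (.inr hu))
  · intro R hR
    obtain ⟨hF, hR⟩ := (isTargetSet_iff_of_forced hT).mp hR
    set F : Finset V := univ.filter fun u => (univ.filter fun v => G.Adj u v).card < τ u with hFdef
    have hFR : F ⊆ R := fun u hu => hF u (by simpa [hFdef] using hu)
    have hRF : IsTargetSet G T (R \ F) := by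
      rw [isTargetSet_iff] at hR ⊢
      intro P hP hcl
      refine hR P (fun u hu => ?_) hcl
      by_cases huF : u ∈ F
      · refine hcl u ?_
        rw [hT, if_pos (by simpa [hFdef] using huF)]
        exact Nat.zero_le _
      · exact hP (mem_sdiff.mpr ⟨hu, huF⟩)
    have h1 := hS.2 _ hRF
    have h2 : S' ⊆ F ∪ S := by
      intro u hu
      simpa [hFdef] using (hS' u).mp hu
    have h3 := card_le_card h2
    have h4 := card_union_le F S
    have h5 := card_sdiff_add_card_eq_card hFR
    omega

end Closed

/-! ### Activation orders of a vertex cover. -/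

section Levels

variable {V : Type*} [Fintype V] [DecidableEq V] {G : SimpleGraph V} [DecidableRel G.Adj]
  {T : V → ℕ} {C S : Finset V}

/-- The levels `ℓ` of the vertices of a vertex cover `C` witness that all of `C` is activated
from `S`: vertices of level `0` are in `S`, and a vertex of a higher level has enough neighbours
that are in `S`, or in `C` at a lower level, or activated by the lower levels of `C`. -/
def IsLevelling (G : SimpleGraph V) [DecidableRel G.Adj] (T : V → ℕ) (C S : Finset V)
    (ℓ : V → ℕ) : Prop :=
  (∀ c ∈ C, ℓ c = 0 → c ∈ S) ∧ ∀ c ∈ C, ℓ c ≠ 0 →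
    T c ≤ (univ.filter fun u => G.Adj c u ∧ (u ∈ C ∧ ℓ u < ℓ c ∨
      u ∉ C ∧ (u ∈ S ∨ T u ≤ (univ.filter fun v => G.Adj u v ∧ v ∈ C ∧ ℓ v < ℓ c).card))).card

/-- Strong induction on the level puts `C` into every closed superset of `S`. A vertex outside `C`
then has all its neighbours in that superset, and its threshold is at most its degree. -/
theorem IsLevelling.isTargetSet {ℓ : V → ℕ} (hC : ∀ u v, G.Adj u v → u ∈ C ∨ v ∈ C)
    (hT : ∀ u, T u ≤ (univ.filter fun v => G.Adj u v).card) (h : IsLevelling G T C S ℓ) :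
    IsTargetSet G T S := by
  rw [isTargetSet_iff]
  intro P hS hP
  have hCP : ∀ j, ∀ c ∈ C, ℓ c = j → c ∈ P := by
    intro j
    induction j using Nat.strong_induction_on with
    | _ j ih =>
      intro c hc hj
      rcases Nat.eq_zero_or_pos j with h0 | h0
      · exact hS (h.1 c hc (hj.trans h0))
      · refine hP c ((h.2 c hc (by omega)).trans (card_le_card ?_))
        refine monotone_filter_right _ fun u _ hu => ⟨hu.1, ?_⟩
        rcases hu.2 with ⟨hu1, hu2⟩ | ⟨hu1, hu2 | hu2⟩
        · exact ih _ (by omega) u hu1 rfl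
        · exact hS hu2
        · refine hP u (hu2.trans (card_le_card ?_))
          exact monotone_filter_right _ fun v _ hv => ⟨hv.1, ih _ (by omega) v hv.2.1 rfl⟩
  intro u
  by_cases hu : u ∈ C
  · exact hCP _ u hu rfl
  · refine hP u ((hT u).trans (card_le_card ?_))
    exact monotone_filter_right _ fun v _ hv => ⟨hv, hCP _ v ((hC u v hv).resolve_left hu) rfl⟩

/-- One step of the diffusion, seen from the vertex cover `C`. -/
def coverStep (G : SimpleGraph V) [DecidableRel G.Adj] (T : V → ℕ) (C S P : Finset V) :
    Finset V :=
  P ∪ C.filter fun c => T c ≤ (univ.filter fun u => G.Adj c u ∧ (u ∈ P ∨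
      u ∉ C ∧ (u ∈ S ∨ T u ≤ (univ.filter fun v => G.Adj u v ∧ v ∈ P).card))).card

/-- Adding to a fixed `P` the outside vertices that are selected or activated by `P` yields a closed
set containing `S`, hence all vertices; its part inside `C` is `P`. -/
theorem eq_of_coverStep_eq {P : Finset V} (hC : ∀ u v, G.Adj u v → u ∈ C ∨ v ∈ C)
    (h : IsTargetSet G T S) (hPC : P ⊆ C) (hSP : ∀ c ∈ C, c ∈ S → c ∈ P)
    (hP : coverStep G T C S P = P) : P = C := by
  refine subset_antisymm hPC fun c hc => ?_
  set Q := P ∪ univ.filter fun u =>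
    u ∉ C ∧ (u ∈ S ∨ T u ≤ (univ.filter fun v => G.Adj u v ∧ v ∈ P).card) with hQ
  have hmem : ∀ u, u ∈ Q ↔ u ∈ P ∨
      u ∉ C ∧ (u ∈ S ∨ T u ≤ (univ.filter fun v => G.Adj u v ∧ v ∈ P).card) := by
    intro u
    simp [hQ]
  have := isTargetSet_iff.mp h Q (fun u hu => ?_) (fun u hu => ?_) c
  · rcases (hmem c).mp this with h | h
    · exact h
    · exact absurd hc h.1
  · rw [hmem]
    by_cases huC : u ∈ C
    · exact .inl (hSP u huC hu)
    · exact .inr ⟨huC, .inl hu⟩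
  · simp only [hmem] at hu ⊢
    by_cases huC : u ∈ C
    · left
      rw [← hP]
      refine mem_union_right _ (mem_filter.mpr ⟨huC, hu⟩)
    · refine .inr ⟨huC, .inr (hu.trans (card_le_card ?_))⟩
      -- The complement of `C` is independent, so only neighbours in `P` count for `u`.
      refine monotone_filter_right _ fun v _ hv => ⟨hv.1, hv.2.resolve_right fun h' => ?_⟩
      exact h'.1 ((hC u v hv.1).resolve_left huC)

/-- The level of `c` is the first round of `coverStep`, started from `S ∩ C`, that contains `c`.
Each round before `C` is exhausted gains a vertex, so `|C|` rounds suffice. -/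
theorem exists_isLevelling (hC : ∀ u v, G.Adj u v → u ∈ C ∨ v ∈ C) (h : IsTargetSet G T S) :
    ∃ ℓ : V → ℕ, (∀ c, ℓ c ≤ C.card) ∧ IsLevelling G T C S ℓ := by
  let P : ℕ → Finset V := fun j => (coverStep G T C S)^[j] (S ∩ C)
  have hsucc : ∀ j, P (j + 1) = coverStep G T C S (P j) :=
    fun j => Function.iterate_succ_apply' _ _ _
  have hmono : ∀ j, P j ⊆ P (j + 1) := fun j => by
    rw [hsucc]
    exact subset_union_left
  have hmono' : Monotone P := monotone_nat_of_le_succ hmono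
  have hPC : ∀ j, P j ⊆ C := by
    intro j
    induction j with
    | zero => exact inter_subset_right
    | succ j ih =>
      rw [hsucc]
      exact union_subset ih (filter_subset _ _)
  have hSP : ∀ j, ∀ c ∈ C, c ∈ S → c ∈ P j := fun j c hc hs =>
    hmono' (Nat.zero_le j) (mem_inter.mpr ⟨hs, hc⟩)
  have hgrow : ∀ j, P j = C ∨ j ≤ (P j).card := by
    intro j
    induction j with
    | zero => exact .inr (Nat.zero_le _)
    | succ j ih =>
      by_cases hj : P j = C
      · exact .inl (subset_antisymm (hPC _) (hj ▸ hmono j))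
      · right
        have hlt : P j ⊂ P (j + 1) := by
          refine (hmono j).ssubset_of_ne fun heq => hj ?_
          refine eq_of_coverStep_eq hC h (hPC j) (hSP j) ?_
          rw [← hsucc, ← heq]
        have := card_lt_card hlt
        have := ih.resolve_left hj
        omega
  have hfull : P C.card = C := by
    rcases hgrow C.card with h | h
    · exact h
    · exact eq_of_subset_of_card_le (hPC _) h
  -- The implication makes the level `0` outside `C`, so the bound on levels holds for all vertices.
  have hex : ∀ c, ∃ j, c ∈ C → c ∈ P j := fun c => ⟨C.card, fun hc => by rwa [hfull]⟩
  classical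
  let ℓ : V → ℕ := fun c => Nat.find (hex c)
  have hlt : ∀ c j, (c ∈ C ∧ ℓ c < j + 1) ↔ c ∈ P j := by
    intro c j
    constructor
    · rintro ⟨hc, hj⟩
      exact hmono' (Nat.lt_succ_iff.mp hj) (Nat.find_spec (hex c) hc)
    · intro hc
      exact ⟨hPC _ hc, Nat.lt_succ_of_le (Nat.find_min' _ fun _ => hc)⟩
  refine ⟨ℓ, fun c => Nat.find_min' _ fun hc => by rwa [hfull], fun c hc h0 => ?_,
    fun c hc h0 => ?_⟩
  · have : c ∈ P 0 := (hlt c 0).mp ⟨hc, by omega⟩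
    exact (mem_inter.mp this).1
  · obtain ⟨j, hj⟩ := Nat.exists_eq_succ_of_ne_zero h0
    have h1 : c ∈ P (j + 1) := (hlt c (j + 1)).mp ⟨hc, by omega⟩
    have h2 : c ∉ P j := fun h' => by
      have := ((hlt c j).mpr h').2
      omega
    rw [hsucc, coverStep, mem_union, mem_filter] at h1
    have h3 := (h1.resolve_left h2).2
    simpa only [← hlt, hj] using h3

end Levels

end TargetSetSelection

/-! ### The layered state space of the algorithm -/

namespace TargetSetSelection

open Finset

open Classical in
/-- The number of `u < n` that satisfy `p`. -/
noncomputable def count (n : ℕ) (p : ℕ → Prop) : ℕ := ((range n).filter p).card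

open Classical in
theorem count_eq_sum (n : ℕ) (p : ℕ → Prop) : count n p = ∑ u ∈ range n, if p u then 1 else 0 :=
  card_filter _ _

open Classical in
theorem count_succ (n : ℕ) (p : ℕ → Prop) :
    count (n + 1) p = count n p + if p n then 1 else 0 := by
  simp only [count_eq_sum, sum_range_succ]

theorem count_zero (p : ℕ → Prop) : count 0 p = 0 := by simp [count]

theorem count_le (n : ℕ) (p : ℕ → Prop) : count n p ≤ n := by
  classical
  exact (card_filter_le _ _).trans (card_range n).le

theorem count_congr {n : ℕ} {p q : ℕ → Prop} (h : ∀ u < n, p u ↔ q u) : count n p = count n q := by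
  classical
  exact congrArg card (filter_congr fun u hu => h u (mem_range.mp hu))

theorem count_le_count {n : ℕ} {p q : ℕ → Prop} (h : ∀ u < n, p u → q u) :
    count n p ≤ count n q := by
  classical
  refine card_le_card fun u hu => ?_
  simp only [mem_filter, mem_range] at hu ⊢
  exact ⟨hu.1, h u hu.1 hu.2⟩

theorem count_mono {m n : ℕ} (h : m ≤ n) (p : ℕ → Prop) : count m p ≤ count n p := by
  classical
  exact card_le_card (filter_subset_filter _ (range_mono h))

theorem count_or_le {n : ℕ} {p q r : ℕ → Prop} (h : ∀ u < n, r u → p u ∨ q u) :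
    count n r ≤ count n p + count n q := by
  classical
  refine le_trans (card_le_card fun u hu => ?_) (card_union_le _ _)
  simp only [mem_filter, mem_range, mem_union] at hu ⊢
  rcases h u hu.1 hu.2 with h | h <;> simp [h, hu.1]

theorem add_count_le {n : ℕ} {p q r : ℕ → Prop} (hp : ∀ u < n, p u → r u ∧ ¬ q u)
    (hq : ∀ u < n, q u → r u) : count n p + count n q ≤ count n r := by
  classical
  rw [count, count, ← card_union_of_disjoint]
  · refine card_le_card fun u hu => ?_
    simp only [mem_filter, mem_range, mem_union] at hu ⊢
    rcases hu with hu | hu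
    · exact ⟨hu.1, (hp u hu.1 hu.2).1⟩
    · exact ⟨hu.1, hq u hu.1 hu.2⟩
  · refine disjoint_left.mpr fun u hu hu' => ?_
    simp only [mem_filter, mem_range] at hu hu'
    exact (hp u hu.1 hu.2).2 hu'.2

theorem card_filter_fin {n : ℕ} (p : Fin n → Prop) [DecidablePred p] (q : ℕ → Prop)
    (h : ∀ u : Fin n, p u ↔ q u) : (univ.filter p).card = count n q := by
  classical
  rw [count_eq_sum, sum_range, card_filter]
  exact sum_congr rfl fun u _ => if_congr (h u) rfl rfl

/-- A graph on `0, …, n - 1` with thresholds `T` and a vertex cover `C`, together with a set of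
states `y < Y`. A state determines a level `L y c` and a demand `W y c` for every vertex `c` in
the cover, and a number `Z y`. -/
structure Layers where
  n : ℕ
  adj : ℕ → ℕ → Prop
  C : ℕ → Prop
  T : ℕ → ℕ
  Y : ℕ
  L : ℕ → ℕ → ℕ
  W : ℕ → ℕ → ℕ
  Z : ℕ → ℕ

namespace Layers

variable (I : Layers)

/-- The vertex `u` is activated by its neighbours in the cover of a level below `j`. -/
def Pre (ℓ : ℕ → ℕ) (u j : ℕ) : Prop :=
  I.T u ≤ count I.n fun v => I.adj u v ∧ I.C v ∧ ℓ v < j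

/-- The states in which nothing has been selected. -/
def Start (y : ℕ) : Prop := I.Z y = 0 ∧ ∀ c < I.n, I.C c → I.W y c = 0

/-- The moves from state `y'` to state `y` when vertex `i` is processed; the vertex is selected
when `Z` changes. -/
def Trans (i y' y : ℕ) : Prop :=
  (I.Z y = I.Z y' ∨ I.Z y = I.Z y' + 1) ∧ (I.C i → I.L y i = 0 → I.Z y ≠ I.Z y') ∧
    ∀ c < I.n, I.C c → I.L y c = I.L y' c ∧ (I.W y c ≤ I.W y' c ∨
      I.Z y ≠ I.Z y' ∧ I.W y c ≤ I.W y' c + 1 ∧ ¬ I.C i ∧ I.adj c i ∧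
        ¬ I.Pre (I.L y) i (I.L y c))

/-- The states that can be reached by processing the vertices below `i`. -/
def Reach : ℕ → ℕ → Prop
  | 0, y => I.Start y
  | i + 1, y => ∃ y' < I.Y, Reach i y' ∧ I.Trans i y' y

/-- The states whose levels are realized when the demands are met. -/
def Good (y : ℕ) : Prop :=
  ∀ c < I.n, I.C c → I.L y c ≠ 0 → I.T c ≤ I.W y c + count I.n fun u =>
    I.adj c u ∧ (I.C u ∧ I.L y u < I.L y c ∨ ¬ I.C u ∧ I.Pre (I.L y) u (I.L y c))

/-- The version of `IsLevelling` for vertices that are natural numbers. -/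
def Levelling (ℓ : ℕ → ℕ) (S : ℕ → Prop) : Prop :=
  (∀ c < I.n, I.C c → ℓ c = 0 → S c) ∧ ∀ c < I.n, I.C c → ℓ c ≠ 0 →
    I.T c ≤ count I.n fun u => I.adj c u ∧ (I.C u ∧ ℓ u < ℓ c ∨
      ¬ I.C u ∧ (S u ∨ I.Pre ℓ u (ℓ c)))

variable {I}

theorem pre_congr {ℓ ℓ' : ℕ → ℕ} (h : ∀ c < I.n, I.C c → ℓ c = ℓ' c) (u j : ℕ) :
    I.Pre ℓ u j ↔ I.Pre ℓ' u j := by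
  unfold Pre
  rw [count_congr fun v hv => ?_]
  constructor
  · rintro ⟨h1, h2, h3⟩
    exact ⟨h1, h2, h v hv h2 ▸ h3⟩
  · rintro ⟨h1, h2, h3⟩
    exact ⟨h1, h2, (h v hv h2).symm ▸ h3⟩

/-- Levels never change along a path, and `Z` counts the selected vertices. A move may raise `W` for
`c` only when it selects a helper of `c` that is not free, so `W` never exceeds the number of such
helpers; these are disjoint from the helpers counted in `Good`. -/
theorem levelling_of_path {ys : ℕ → ℕ} (h0 : I.Start (ys 0))
    (hs : ∀ i < I.n, I.Trans i (ys i) (ys (i + 1))) (hg : I.Good (ys I.n)) :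
    I.Levelling (I.L (ys I.n)) (fun i => I.Z (ys (i + 1)) ≠ I.Z (ys i)) ∧
      count I.n (fun i => I.Z (ys (i + 1)) ≠ I.Z (ys i)) = I.Z (ys I.n) := by
  have hL : ∀ j i, i + j = I.n → ∀ c < I.n, I.C c → I.L (ys i) c = I.L (ys I.n) c := by
    intro j
    induction j with
    | zero => rintro i rfl c _ _; rfl
    | succ j ih =>
      intro i hi c hc hcC
      rw [← ((hs i (by omega)).2.2 c hc hcC).1]
      exact ih (i + 1) (by omega) c hc hcC
  have hL' : ∀ i ≤ I.n, ∀ c < I.n, I.C c → I.L (ys i) c = I.L (ys I.n) c :=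
    fun i hi => hL (I.n - i) i (by omega)
  have hZ : ∀ i ≤ I.n, count i (fun i => I.Z (ys (i + 1)) ≠ I.Z (ys i)) = I.Z (ys i) := by
    intro i
    induction i with
    | zero => intro _; rw [count_zero, h0.1]
    | succ i ih =>
      intro hi
      rw [count_succ, ih (by omega)]
      have := (hs i (by omega)).1
      split_ifs with h
      · exact (this.resolve_left h).symm
      · rw [not_not] at h
        omega
  have hW : ∀ i ≤ I.n, ∀ c < I.n, I.C c → I.W (ys i) c ≤ count i fun u =>
      I.Z (ys (u + 1)) ≠ I.Z (ys u) ∧ ¬ I.C u ∧ I.adj c u ∧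
        ¬ I.Pre (I.L (ys I.n)) u (I.L (ys I.n) c) := by
    intro i
    induction i with
    | zero => intro _ c hc hcC; rw [h0.2 c hc hcC]; exact Nat.zero_le _
    | succ i ih =>
      intro hi c hc hcC
      have h1 := ih (by omega) c hc hcC
      rw [count_succ]
      rcases ((hs i (by omega)).2.2 c hc hcC).2 with h | ⟨h2, h3, h4, h5, h6⟩
      · omega
      · rw [pre_congr (hL' (i + 1) hi), hL' (i + 1) hi c hc hcC] at h6
        rw [if_pos ⟨h2, h4, h5, h6⟩]
        omega
  refine ⟨⟨fun c hc hcC h => ?_, fun c hc hcC h => ?_⟩, hZ _ le_rfl⟩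
  · exact (hs c hc).2.1 hcC ((hL' (c + 1) hc c hc hcC).trans h)
  · refine (hg c hc hcC h).trans ((Nat.add_le_add_right (hW _ le_rfl c hc hcC) _).trans ?_)
    refine add_count_le ?_ ?_
    · rintro u hu ⟨h1, h2, h3, h4⟩
      exact ⟨⟨h3, .inr ⟨h2, .inl h1⟩⟩, fun h' => by tauto⟩
    · rintro u hu ⟨h1, h2⟩
      exact ⟨h1, by tauto⟩

/-- The path follows `S`: the state of layer `i` records the exact counts over the vertices below
`i`. All counts are at most the size of `S`, hence below `B`, so each of these states has a code. -/
theorem exists_reach {B : ℕ} (henc : ∀ (ℓ w : ℕ → ℕ) (z : ℕ), (∀ c, ℓ c < B) → (∀ c, w c < B) →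
      z < B → ∃ y < I.Y, I.Z y = z ∧ ∀ c < I.n, I.C c → I.L y c = ℓ c ∧ I.W y c = w c)
    {ℓ : ℕ → ℕ} {S : ℕ → Prop} (h : I.Levelling ℓ S) (hℓ : ∀ c, ℓ c < B)
    (hS : count I.n S < B) :
    ∃ y < I.Y, I.Reach I.n y ∧ I.Good y ∧ I.Z y = count I.n S := by
  have key : ∀ i ≤ I.n, ∃ y < I.Y, I.Reach i y ∧ I.Z y = count i S ∧ ∀ c < I.n, I.C c →
      I.L y c = ℓ c ∧ I.W y c = count i fun u =>
        S u ∧ ¬ I.C u ∧ I.adj c u ∧ ¬ I.Pre ℓ u (ℓ c) := by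
    intro i
    induction i with
    | zero =>
      intro _
      obtain ⟨y, hy, hz, hc⟩ := henc ℓ (fun _ => 0) 0 hℓ (fun _ => by omega) (by omega)
      exact ⟨y, hy, ⟨hz, fun c h1 h2 => (hc c h1 h2).2⟩, by rw [hz, count_zero],
        fun c h1 h2 => ⟨(hc c h1 h2).1, by rw [(hc c h1 h2).2, count_zero]⟩⟩
    | succ i ih =>
      intro hi
      obtain ⟨y', hy', hr, hz', hc'⟩ := ih (by omega)
      have hle : count (i + 1) S < B := (count_mono hi S).trans_lt hS
      obtain ⟨y, hy, hz, hc⟩ := henc ℓ (fun c => count (i + 1) fun u =>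
        S u ∧ ¬ I.C u ∧ I.adj c u ∧ ¬ I.Pre ℓ u (ℓ c)) (count (i + 1) S) hℓ
        (fun c => (count_le_count fun u _ hu => hu.1).trans_lt hle) hle
      refine ⟨y, hy, ⟨y', hy', hr, ?_, ?_, ?_⟩, hz, hc⟩
      · rw [hz, hz', count_succ]
        split_ifs <;> simp
      · intro hC h0
        rw [hz, hz', count_succ, if_pos (h.1 i hi hC ((hc i hi hC).1 ▸ h0))]
        omega
      · intro c hcn hcC
        obtain ⟨h1, h2⟩ := hc c hcn hcC
        obtain ⟨h3, h4⟩ := hc' c hcn hcC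
        refine ⟨h1.trans h3.symm, ?_⟩
        rw [pre_congr (fun c h h' => (hc c h h').1), h1, h2, h4, hz, hz', count_succ, count_succ]
        by_cases hp : S i ∧ ¬ I.C i ∧ I.adj c i ∧ ¬ I.Pre ℓ i (ℓ c)
        · right
          rw [if_pos hp, if_pos hp.1]
          exact ⟨by omega, le_rfl, hp.2⟩
        · left
          rw [if_neg hp]
          exact le_rfl
  obtain ⟨y, hy, hr, hz, hc⟩ := key I.n le_rfl
  refine ⟨y, hy, hr, fun c hcn hcC h0 => ?_, hz⟩
  obtain ⟨h1, h2⟩ := hc c hcn hcC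
  rw [h1] at h0 ⊢
  refine (h.2 c hcn hcC h0).trans ?_
  rw [h2]
  refine count_or_le fun u hu hr => ?_
  rw [pre_congr (fun c h h' => (hc c h h').1)]
  obtain ⟨ha, ⟨h3, h4⟩ | ⟨h3, h4⟩⟩ := hr
  · exact .inr ⟨ha, .inl ⟨h3, (hc u hu h3).1.symm ▸ h4⟩⟩
  · by_cases hp : I.Pre ℓ u (ℓ c)
    · exact .inr ⟨ha, .inr ⟨h3, hp⟩⟩
    · exact .inl ⟨h4.resolve_right hp, h3, ha, hp⟩

end Layers

/-! ### Encoding states as numbers. -/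

theorem exists_digits {B : ℕ} (f : ℕ → ℕ) (hf : ∀ p, f p < B) (m : ℕ) :
    ∃ y < B ^ m, ∀ p < m, y / B ^ p % B = f p := by
  have hB : 0 < B := (Nat.zero_le _).trans_lt (hf 0)
  induction m with
  | zero => exact ⟨0, by simp, by simp⟩
  | succ m ih =>
    obtain ⟨y, hy, hd⟩ := ih
    refine ⟨y + B ^ m * f m, ?_, fun p hp => ?_⟩
    · have : B ^ m * (f m + 1) ≤ B ^ m * B := Nat.mul_le_mul_left _ (hf m)
      rw [pow_succ]
      linarith
    · rcases Nat.lt_succ_iff_lt_or_eq.mp hp with hp | rfl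
      · obtain ⟨q, rfl⟩ := Nat.exists_eq_add_of_lt hp
        rw [show y + B ^ (p + q + 1) * f (p + q + 1) = y + B ^ p * (B * (B ^ q * f (p + q + 1)))
          by ring, Nat.add_mul_div_left _ _ (by positivity), Nat.add_mul_mod_self_left, hd p hp]
      · rw [Nat.add_mul_div_left _ _ (by positivity), Nat.div_eq_of_lt hy, zero_add,
          Nat.mod_eq_of_lt (hf _)]

/-- States are numbers with `2 * k + 1` digits, where `k` is the number of elements of `C`. -/
theorem exists_state {n B k : ℕ} {C : ℕ → Prop} (hk : k = count n C) (ℓ w : ℕ → ℕ) (z : ℕ)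
    (hℓ : ∀ c, ℓ c < B) (hw : ∀ c, w c < B) (hz : z < B) :
    ∃ y < B ^ (2 * k + 1), y / B ^ (2 * k) = z ∧ ∀ c < n, C c →
      y / B ^ (2 * count c C) % B = ℓ c ∧ y / B ^ (2 * count c C + 1) % B = w c := by
  classical
  -- The number of smaller cover vertices enumerates the cover injectively. The vertex of rank `p`
  -- owns the digits `2p` (level) and `2p + 1` (demand); digit `2k` is the size.
  have hinv : ∀ p, ∃ c, ∀ c' < n, C c' → count c' C = p → c = c' := by
    intro p
    by_cases h : ∃ c < n, C c ∧ count c C = p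
    · obtain ⟨c, hc, hcC, rfl⟩ := h
      refine ⟨c, fun c' hc' hcC' he => ?_⟩
      have hlt : ∀ a b, C a → a < b → count a C < count b C := by
        intro a b ha hab
        have := count_mono (Nat.succ_le_of_lt hab) C
        rw [Nat.succ_eq_add_one, count_succ, if_pos ha] at this
        omega
      rcases lt_trichotomy c c' with h | h | h
      · have := hlt c c' hcC h
        omega
      · exact h
      · have := hlt c' c hcC' h
        omega
    · exact ⟨0, fun c' h1 h2 h3 => absurd ⟨c', h1, h2, h3⟩ h⟩
  choose inv hinv using hinv
  obtain ⟨y, hy, hd⟩ := exists_digits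
    (fun p => if p = 2 * k then z else if p % 2 = 0 then ℓ (inv (p / 2)) else w (inv (p / 2)))
    (fun p => by split_ifs; exacts [hz, hℓ _, hw _]) (2 * k + 1)
  refine ⟨y, hy, ?_, fun c hc hcC => ?_⟩
  · have h := hd (2 * k) (by omega)
    rw [if_pos rfl, Nat.mod_eq_of_lt] at h
    · exact h
    · rw [Nat.div_lt_iff_lt_mul (Nat.pow_pos ((Nat.zero_le _).trans_lt hz))]
      rwa [pow_succ, mul_comm] at hy
  · have hlt : count c C < k := by
      have := count_mono (Nat.succ_le_of_lt hc) C
      rw [Nat.succ_eq_add_one, count_succ, if_pos hcC] at this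
      omega
    have h1 := hd (2 * count c C) (by omega)
    have h2 := hd (2 * count c C + 1) (by omega)
    rw [if_neg (by omega), if_pos (by omega), Nat.mul_div_cancel_left _ (by omega),
      hinv _ c hc hcC rfl] at h1
    rw [if_neg (by omega), if_neg (by omega),
      show (2 * count c C + 1) / 2 = count c C by omega, hinv _ c hc hcC rfl] at h2
    exact ⟨h1, h2⟩

/-! ### Greedy matchings -/

/-- `M` is the greedy matching of the graph on `0, …, n - 1`: the vertices `u` are processed in
increasing order, and `M u < n` is the partner that `u` receives when it is processed. -/
def IsGreedy (n : ℕ) (adj : ℕ → ℕ → Prop) (M : ℕ → ℕ) : Prop :=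
  ∀ u < n, (∀ v < n, adj u v → u < v → (∀ u' < u, M u' ≠ u ∧ M u' ≠ v) → M u < n) ∧
    (M u < n → adj u (M u) ∧ u < M u ∧ ∀ u' < u, M u' ≠ u ∧ M u' ≠ M u)

/-- The vertices of the greedy matching. -/
def Matched (n : ℕ) (M : ℕ → ℕ) (v : ℕ) : Prop := M v < n ∨ ∃ u < n, M u = v

/-- If both ends of an edge were unmatched, the smaller end would have received a partner when it
was processed. -/
theorem IsGreedy.cover {n : ℕ} {adj : ℕ → ℕ → Prop} {M : ℕ → ℕ} (h : IsGreedy n adj M)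
    {u v : ℕ} (huv : u < v) (hv : v < n) (ha : adj u v) : Matched n M u ∨ Matched n M v := by
  by_contra hcon
  simp only [Matched, not_or, not_exists, not_and] at hcon
  exact hcon.1.1 ((h u (by omega)).1 v hv ha huv fun u' hu' =>
    ⟨hcon.1.2 u' (by omega), hcon.2.2 u' (by omega)⟩)

/-- The matching edges are disjoint and each contains a vertex of `K`; picking one gives an
injection from the edges into `K`, and an edge has two ends. -/
theorem IsGreedy.count_le {n : ℕ} {adj : ℕ → ℕ → Prop} {M : ℕ → ℕ} (h : IsGreedy n adj M)
    {K : ℕ → Prop} (hK : ∀ u < n, ∀ v < n, adj u v → K u ∨ K v) :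
    count n (Matched n M) ≤ 2 * count n K := by
  classical
  have h1 : count n (Matched n M) ≤ count n (fun v => M v < n) + count n fun v => ∃ u < n, M u = v :=
    count_or_le fun u _ hu => hu
  have h2 : (count n fun v => ∃ u < n, M u = v) ≤ count n fun v => M v < n := by
    refine le_trans (card_le_card fun v hv => ?_) (card_image_le (f := M))
    simp only [mem_filter, mem_range, mem_image] at hv ⊢
    obtain ⟨hv, u, hu, rfl⟩ := hv
    exact ⟨u, ⟨hu, hv⟩, rfl⟩
  have h3 : (count n fun v => M v < n) ≤ count n K := by
    refine card_le_card_of_injOn (fun u => if K u then u else M u) (fun u hu => ?_)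
      (fun u hu v hv huv => ?_)
    · simp only [coe_filter, mem_range, Set.mem_ofPred_eq] at hu ⊢
      split_ifs with hk
      · exact ⟨hu.1, hk⟩
      · exact ⟨hu.2, (hK u hu.1 _ hu.2 ((h u hu.1).2 hu.2).1).resolve_left hk⟩
    · simp only [coe_filter, mem_range, Set.mem_ofPred_eq] at hu hv
      obtain ⟨-, hu1, hu2⟩ := (h u hu.1).2 hu.2
      obtain ⟨-, hv1, hv2⟩ := (h v hv.1).2 hv.2
      rcases lt_trichotomy u v with hlt | heq | hlt
      · exfalso
        have := hv2 u hlt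
        simp only at huv
        split_ifs at huv <;> omega
      · exact heq
      · exfalso
        have := hu2 v hlt
        simp only at huv
        split_ifs at huv <;> omega
  omega

end TargetSetSelection

/-! ### The program -/

namespace RAM.BExpr

open TargetSetSelection

def lt (e f : BExpr) : BExpr := .sub f e

def eq (e f : BExpr) : BExpr := .ite (.add (.sub e f) (.sub f e)) (.const 0) (.const 1)

def not (e : BExpr) : BExpr := .ite e (.const 0) (.const 1)

def and (e f : BExpr) : BExpr := .ite e f (.const 0)

def or (e f : BExpr) : BExpr := .ite e (.const 1) f

def le (e f : BExpr) : BExpr := not (lt f e)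

def imp (e f : BExpr) : BExpr := .ite e f (.const 1)

/-- The number of values of variable `x` below variable `b` that satisfy `e`. -/
def cnt (x b : ℕ) (e : BExpr) : BExpr :=
  .sum x (.ite (and (lt (.var x) (.var b)) e) (.const 1) (.const 0))

/-- Bounded universal quantification. -/
def all (x b : ℕ) (e : BExpr) : BExpr := not (cnt x b (not e))

/-- The expression `e`, read as a condition, is satisfied. -/
def Holds (N : ℕ) (A : ℕ → ℕ → ℕ) (e : BExpr) (ρ : ℕ → ℕ) : Prop := e.eval N A ρ ≠ 0

/-! ### Semantics of conditions and of bounded arithmetic. -/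

variable {N : ℕ} {A : ℕ → ℕ → ℕ} {ρ : ℕ → ℕ}

theorem holds_lt {e f : BExpr} : (lt e f).Holds N A ρ ↔ e.eval N A ρ < f.eval N A ρ := by
  simp only [Holds, lt, eval]
  omega

theorem holds_eq {e f : BExpr} : (eq e f).Holds N A ρ ↔ e.eval N A ρ = f.eval N A ρ := by
  simp only [Holds, eq, eval]
  split_ifs <;> simp <;> omega

theorem holds_not {e : BExpr} : (not e).Holds N A ρ ↔ ¬ e.Holds N A ρ := by
  simp only [Holds, not, eval]
  split_ifs <;> simp_all

theorem holds_le {e f : BExpr} : (le e f).Holds N A ρ ↔ e.eval N A ρ ≤ f.eval N A ρ := by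
  rw [le, holds_not, holds_lt, not_lt]

theorem holds_imp {e f : BExpr} : (imp e f).Holds N A ρ ↔ (e.Holds N A ρ → f.Holds N A ρ) := by
  simp only [Holds, imp, eval]
  split_ifs <;> simp_all

theorem holds_and {e f : BExpr} : (and e f).Holds N A ρ ↔ e.Holds N A ρ ∧ f.Holds N A ρ := by
  simp only [Holds, and, eval]
  split_ifs <;> simp_all

theorem holds_or {e f : BExpr} : (or e f).Holds N A ρ ↔ e.Holds N A ρ ∨ f.Holds N A ρ := by
  simp only [Holds, or, eval]
  split_ifs <;> simp_all

theorem holds_read {a : ℕ} {e : BExpr} : (read a e).Holds N A ρ ↔ A a (e.eval N A ρ) ≠ 0 := .rfl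

theorem holds_letv {x : ℕ} {e f : BExpr} : (letv x e f).Holds N A ρ ↔
    f.Holds N A (Function.update ρ x (e.eval N A ρ)) := .rfl

open Classical in
theorem eval_ite_holds {c e f : BExpr} : (ite c e f).eval N A ρ =
    if c.Holds N A ρ then e.eval N A ρ else f.eval N A ρ := by
  rw [eval]
  exact if_congr .rfl rfl rfl

open Classical in
theorem holds_ite {c e f : BExpr} : (ite c e f).Holds N A ρ ↔
    if c.Holds N A ρ then e.Holds N A ρ else f.Holds N A ρ := by
  rw [Holds, eval_ite_holds]
  split_ifs <;> rfl

theorem eval_var {x : ℕ} : (var x).eval N A ρ = ρ x := rfl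

theorem eval_const {k : ℕ} : (const k).eval N A ρ = k := rfl

theorem eval_read {a : ℕ} {e : BExpr} : (read a e).eval N A ρ = A a (e.eval N A ρ) := rfl

theorem eval_add {e f : BExpr} : (add e f).eval N A ρ = e.eval N A ρ + f.eval N A ρ := rfl

theorem eval_sub {e f : BExpr} : (sub e f).eval N A ρ = e.eval N A ρ - f.eval N A ρ := rfl

theorem holds_var {x : ℕ} : (var x).Holds N A ρ ↔ ρ x ≠ 0 := .rfl

theorem eval_letv {x : ℕ} {e f : BExpr} :
    (letv x e f).eval N A ρ = f.eval N A (Function.update ρ x (e.eval N A ρ)) := rfl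

open Classical in
theorem eval_cnt {x b : ℕ} {e : BExpr} (hxb : x ≠ b) (hb : ρ b ≤ N) :
    (cnt x b e).eval N A ρ = count (ρ b) fun u => e.Holds N A (Function.update ρ x u) := by
  rw [count_eq_sum, cnt, eval, ← Finset.sum_subset (Finset.range_mono hb)]
  · refine Finset.sum_congr rfl fun u hu => ?_
    rw [eval_ite_holds]
    refine if_congr ?_ rfl rfl
    simp [holds_and, holds_lt, eval, Function.update_of_ne hxb.symm, Finset.mem_range.mp hu]
  · intro u _ hu
    rw [eval_ite_holds, if_neg]
    · rfl
    · simpa [holds_and, holds_lt, eval, Function.update_of_ne hxb.symm] using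
        fun h => absurd h (by simpa using hu)

theorem holds_cnt {x b : ℕ} {e : BExpr} (hxb : x ≠ b) (hb : ρ b ≤ N) :
    (cnt x b e).Holds N A ρ ↔ ∃ u < ρ b, e.Holds N A (Function.update ρ x u) := by
  classical
  rw [Holds, eval_cnt hxb hb, count, Ne, Finset.card_eq_zero, ← Ne,
    ← Finset.nonempty_iff_ne_empty]
  simp [Finset.Nonempty]

theorem holds_all {x b : ℕ} {e : BExpr} (hxb : x ≠ b) (hb : ρ b ≤ N) :
    (all x b e).Holds N A ρ ↔ ∀ u < ρ b, e.Holds N A (Function.update ρ x u) := by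
  rw [all, holds_not, holds_cnt hxb hb]
  simp [holds_not]

/-- Division with a bounded result. -/
def bdiv (N a b : ℕ) : ℕ := ∑ i ∈ Finset.range N, if (i + 1) * b ≤ a then 1 else 0

theorem bdiv_eq {N a b : ℕ} (hb : 0 < b) (ha : a ≤ N) : bdiv N a b = a / b := by
  have h : (Finset.range N).filter (fun i => (i + 1) * b ≤ a) = Finset.range (a / b) := by
    ext i
    simp only [Finset.mem_filter, Finset.mem_range, ← Nat.le_div_iff_mul_le hb]
    have := Nat.div_le_self a b
    omega
  rw [bdiv, ← Finset.card_filter, h, Finset.card_range]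

theorem eval_div {e f : BExpr} :
    (div e f).eval N A ρ = bdiv N (e.eval N A ρ) (f.eval N A ρ) := rfl

/-- Multiplication is repeated addition over `N` rounds, so only the first factor has to be bounded
by `N`. -/
theorem eval_mul {e f : BExpr} (h : e.eval N A ρ ≤ N) :
    (mul e f).eval N A ρ = e.eval N A ρ * f.eval N A ρ := by
  rw [eval, ← Finset.sum_filter, Finset.sum_const, smul_eq_mul]
  congr 1
  rw [show (Finset.range N).filter (fun i => i < e.eval N A ρ) = Finset.range (e.eval N A ρ) from ?_,
    Finset.card_range]
  ext i
  simp only [Finset.mem_filter, Finset.mem_range]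
  omega

/-- The least value of a variable that satisfies `e`, if there is one. -/
theorem find_spec {x : ℕ} {e : BExpr} {i : ℕ} (hi : i < N)
    (h : e.Holds N A (Function.update ρ x i)) :
    (find x e).eval N A ρ ≤ i ∧
      e.Holds N A (Function.update ρ x ((find x e).eval N A ρ)) := by
  obtain ⟨h1, h2, h3⟩ :=
    boundedFind_spec (fun i => e.eval N A (Function.update ρ x i) ≠ 0) N
  have : (find x e).eval N A ρ ≤ i := by
    by_contra hlt
    exact h2 i (not_le.mp hlt) h
  exact ⟨this, h3 (this.trans_lt hi)⟩

theorem holds_find {x : ℕ} {e : BExpr} (h : (find x e).eval N A ρ < N) :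
    e.Holds N A (Function.update ρ x ((find x e).eval N A ρ)) :=
  (boundedFind_spec (fun i => e.eval N A (Function.update ρ x i) ≠ 0) N).2.2 h

end RAM.BExpr

namespace TargetSetSelection

open RAM RAM.BExpr

/-! Variable `0` holds the number of vertices, and array `0` the adjacency matrix. -/

/-- Variables `u` and `v` are adjacent. -/
def adjExpr (u v : ℕ) : BExpr := .read 0 (.add (.mul (.var 0) (.var u)) (.var v))

/-- The adjacency relation given by the contents `a` of array `0`. -/
def memAdj (n : ℕ) (a : ℕ → ℕ) (u v : ℕ) : Prop := a (n * u + v) ≠ 0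

/-- Array `3` is filled with the greedy matching. -/
def matchingExpr : BExpr :=
  .find 16 (and (and (lt (.var 10) (.var 16)) (lt (.var 16) (.var 0))) (and (adjExpr 10 16)
    (all 15 10 (and (not (eq (.read 3 (.var 15)) (.var 10)))
      (not (eq (.read 3 (.var 15)) (.var 16)))))))

/-- Array `4` is filled with the indicator function of the vertex cover. -/
def coverExpr : BExpr :=
  or (lt (.read 3 (.var 10)) (.var 0)) (cnt 15 0 (eq (.read 3 (.var 15)) (.var 10)))

def forcedExpr : BExpr := lt (cnt 16 0 (adjExpr 10 16)) (.read 1 (.var 10))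

/-- Array `5` is filled with the modified thresholds. -/
def thresholdExpr : BExpr := .ite forcedExpr (.const 0) (.read 1 (.var 10))

/-- Array `7` is filled with the powers of variable `1`. -/
def powerExpr : BExpr :=
  .ite (.var 10) (.mul (.var 1) (.read 7 (.sub (.var 10) (.const 1)))) (.const 1)

/-- The first phase computes a vertex cover (array `4`) with `k` vertices, the modified thresholds
(array `5`), an enumeration of the cover (array `6`), powers of `k + 1` (array `7` and
variable `1`), the number of states (variable `2`) and a bound for the second phase
(variable `3`). -/
def phaseOne : BProg :=
  .seq (.tab 3 10 matchingExpr) <| .seq (.tab 4 10 coverExpr) <|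
  .seq (.tab 5 10 thresholdExpr) <| .seq (.tab 6 10 (cnt 15 10 (.read 4 (.var 15)))) <|
  .seq (.set 1 (.add (cnt 15 0 (.read 4 (.var 15))) (.const 1))) <|
  .seq (.tab 7 10 powerExpr) <|
  .seq (.set 2 (.read 7 (.sub (.add (.var 1) (.var 1)) (.const 1)))) <|
  .set 3 (.mul (.add (.var 0) (.const 2)) (.var 2))

section Eval

variable {N : ℕ} {A : ℕ → ℕ → ℕ} {ρ : ℕ → ℕ}

theorem holds_adjExpr (h : ρ 0 ≤ N) (u v : ℕ) :
    (adjExpr u v).Holds N A ρ ↔ memAdj (ρ 0) (A 0) (ρ u) (ρ v) := by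
  rw [adjExpr, holds_read, eval, eval_mul h]
  rfl

theorem holds_matching (h : ρ 0 ≤ N) (h' : ρ 10 ≤ N) (v : ℕ) :
    (and (and (lt (.var 10) (.var 16)) (lt (.var 16) (.var 0))) (and (adjExpr 10 16)
      (all 15 10 (and (not (eq (.read 3 (.var 15)) (.var 10)))
      (not (eq (.read 3 (.var 15)) (.var 16))))))).Holds N A (Function.update ρ 16 v) ↔
    (ρ 10 < v ∧ v < ρ 0) ∧ memAdj (ρ 0) (A 0) (ρ 10) v ∧ ∀ u < ρ 10, A 3 u ≠ ρ 10 ∧ A 3 u ≠ v := by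
  simp [holds_and, holds_lt, holds_all, holds_not, holds_eq, holds_adjExpr, eval, h, h']

theorem holds_coverExpr (h : ρ 0 ≤ N) :
    coverExpr.Holds N A ρ ↔ Matched (ρ 0) (A 3) (ρ 10) := by
  simp [coverExpr, Matched, holds_or, holds_lt, holds_cnt, holds_eq, eval, h]

theorem holds_forcedExpr (h : ρ 0 ≤ N) :
    forcedExpr.Holds N A ρ ↔ count (ρ 0) (memAdj (ρ 0) (A 0) (ρ 10)) < A 1 (ρ 10) := by
  simp [forcedExpr, holds_lt, eval_cnt, holds_adjExpr, eval, h]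

open Classical in
theorem eval_thresholdExpr (h : ρ 0 ≤ N) : thresholdExpr.eval N A ρ =
    if count (ρ 0) (memAdj (ρ 0) (A 0) (ρ 10)) < A 1 (ρ 10) then 0 else A 1 (ρ 10) := by
  simp [thresholdExpr, eval_ite_holds, holds_forcedExpr, eval, h]

theorem eval_powerExpr (h : ρ 1 ≤ N) : powerExpr.eval N A ρ =
    if ρ 10 ≠ 0 then ρ 1 * A 7 (ρ 10 - 1) else 1 := by
  rw [powerExpr, BExpr.eval, eval_mul h]
  rfl

end Eval

/-- The result of the first phase. -/
structure PhaseOneSpec (n : ℕ) (A : ℕ → ℕ → ℕ) (ρ' : ℕ → ℕ) (A' : ℕ → ℕ → ℕ) : Prop where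
  var_zero : ρ' 0 = n
  arr_zero : A' 0 = A 0
  arr_one : A' 1 = A 1
  greedy : IsGreedy n (memAdj n (A 0)) (A' 3)
  cover : ∀ v < n, A' 4 v ≠ 0 ↔ Matched n (A' 3) v
  threshold : ∀ v < n, count n (memAdj n (A 0) v) < A 1 v ∧ A' 5 v = 0 ∨
    ¬ count n (memAdj n (A 0) v) < A 1 v ∧ A' 5 v = A 1 v
  index : ∀ v < n, A' 6 v = count v fun u => A' 4 u ≠ 0
  base : ρ' 1 = (count n fun u => A' 4 u ≠ 0) + 1
  power : ∀ j < 2 * ρ' 1, A' 7 j = ρ' 1 ^ j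
  states : ρ' 2 = ρ' 1 ^ (2 * (count n fun u => A' 4 u ≠ 0) + 1)
  bound : ρ' 3 = (n + 2) * ρ' 2

/-- The bound `2n + 2` makes room for all exponents up to `2k + 1`, as `k ≤ n`. A failing search
returns this bound, which is at least `n` and so means that there is no partner. -/
theorem phaseOne_spec {n : ℕ} (σ : (ℕ → ℕ) × (ℕ → ℕ → ℕ)) (h0 : σ.1 0 = n) :
    PhaseOneSpec n σ.2 (phaseOne.exec (2 * n + 2) σ).1 (phaseOne.exec (2 * n + 2) σ).2 := by
  classical
  set N := 2 * n + 2 with hN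
  obtain ⟨σ₁, e₁⟩ : ∃ s, s = (BProg.tab 3 10 matchingExpr).exec N σ := ⟨_, rfl⟩
  obtain ⟨σ₂, e₂⟩ : ∃ s, s = (BProg.tab 4 10 coverExpr).exec N σ₁ := ⟨_, rfl⟩
  obtain ⟨σ₃, e₃⟩ : ∃ s, s = (BProg.tab 5 10 thresholdExpr).exec N σ₂ := ⟨_, rfl⟩
  obtain ⟨σ₄, e₄⟩ : ∃ s, s = (BProg.tab 6 10 (cnt 15 10 (.read 4 (.var 15)))).exec N σ₃ :=
    ⟨_, rfl⟩
  obtain ⟨σ₅, e₅⟩ : ∃ s, s = (BProg.set 1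
    (.add (cnt 15 0 (.read 4 (.var 15))) (.const 1))).exec N σ₄ := ⟨_, rfl⟩
  obtain ⟨σ₆, e₆⟩ : ∃ s, s = (BProg.tab 7 10 powerExpr).exec N σ₅ := ⟨_, rfl⟩
  obtain ⟨σ₇, e₇⟩ : ∃ s, s = (BProg.set 2
    (.read 7 (.sub (.add (.var 1) (.var 1)) (.const 1)))).exec N σ₆ := ⟨_, rfl⟩
  obtain ⟨σ₈, e₈⟩ : ∃ s, s = (BProg.set 3
    (.mul (.add (.var 0) (.const 2)) (.var 2))).exec N σ₇ := ⟨_, rfl⟩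
  have e : phaseOne.exec N σ = σ₈ := by
    rw [e₈, e₇, e₆, e₅, e₄, e₃, e₂, e₁]
    rfl
  rw [e]
  have v₁ : ∀ y, y ≠ 10 → σ₁.1 y = σ.1 y := fun y hy => by rw [e₁, BProg.exec_tab_var hy]
  have v₂ : ∀ y, y ≠ 10 → σ₂.1 y = σ₁.1 y := fun y hy => by rw [e₂, BProg.exec_tab_var hy]
  have v₃ : ∀ y, y ≠ 10 → σ₃.1 y = σ₂.1 y := fun y hy => by rw [e₃, BProg.exec_tab_var hy]
  have v₄ : ∀ y, y ≠ 10 → σ₄.1 y = σ₃.1 y := fun y hy => by rw [e₄, BProg.exec_tab_var hy]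
  have v₅ : ∀ y, y ≠ 1 → σ₅.1 y = σ₄.1 y := fun y hy => by rw [e₅, BProg.exec_set_var hy]
  have v₆ : ∀ y, y ≠ 10 → σ₆.1 y = σ₅.1 y := fun y hy => by rw [e₆, BProg.exec_tab_var hy]
  have v₇ : ∀ y, y ≠ 2 → σ₇.1 y = σ₆.1 y := fun y hy => by rw [e₇, BProg.exec_set_var hy]
  have v₈ : ∀ y, y ≠ 3 → σ₈.1 y = σ₇.1 y := fun y hy => by rw [e₈, BProg.exec_set_var hy]
  have a₁ : ∀ b, b ≠ 3 → σ₁.2 b = σ.2 b := fun b hb => by rw [e₁, BProg.exec_tab_arr hb]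
  have a₂ : ∀ b, b ≠ 4 → σ₂.2 b = σ₁.2 b := fun b hb => by rw [e₂, BProg.exec_tab_arr hb]
  have a₃ : ∀ b, b ≠ 5 → σ₃.2 b = σ₂.2 b := fun b hb => by rw [e₃, BProg.exec_tab_arr hb]
  have a₄ : ∀ b, b ≠ 6 → σ₄.2 b = σ₃.2 b := fun b hb => by rw [e₄, BProg.exec_tab_arr hb]
  have a₅ : σ₅.2 = σ₄.2 := by rw [e₅, BProg.exec_set_arr]
  have a₆ : ∀ b, b ≠ 7 → σ₆.2 b = σ₅.2 b := fun b hb => by rw [e₆, BProg.exec_tab_arr hb]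
  have a₇ : σ₇.2 = σ₆.2 := by rw [e₇, BProg.exec_set_arr]
  have a₈ : σ₈.2 = σ₇.2 := by rw [e₈, BProg.exec_set_arr]
  have n₁ : σ₁.1 0 = n := (v₁ 0 (by omega)).trans h0
  have n₂ : σ₂.1 0 = n := (v₂ 0 (by omega)).trans n₁
  have n₄ : σ₄.1 0 = n := by rw [v₄ 0 (by omega), v₃ 0 (by omega), n₂]
  have n₇ : σ₇.1 0 = n := by rw [v₇ 0 (by omega), v₆ 0 (by omega), v₅ 0 (by omega), n₄]
  have c₄ : σ₄.2 4 = σ₂.2 4 := by rw [a₄ 4 (by omega), a₃ 4 (by omega)]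
  have c₈ : σ₈.2 4 = σ₄.2 4 := by rw [a₈, a₇, a₆ 4 (by omega), a₅]
  have m₈ : σ₈.2 3 = σ₁.2 3 := by
    rw [a₈, a₇, a₆ 3 (by omega), a₅, a₄ 3 (by omega), a₃ 3 (by omega), a₂ 3 (by omega)]
  set B := (count n fun u => σ₈.2 4 u ≠ 0) + 1 with hB
  have hBn : B ≤ n + 1 := Nat.succ_le_succ (count_le _ _)
  have b₅ : σ₅.1 1 = B := by
    rw [e₅, BProg.exec_set_self, eval, eval_cnt (by omega) (by omega), n₄, hB, c₈]
    simp only [holds_read, eval, Function.update_self]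
  have b₈ : σ₈.1 1 = B := by rw [v₈ 1 (by omega), v₇ 1 (by omega), v₆ 1 (by omega), b₅]
  have p₆ : ∀ j < N, σ₆.2 7 j = B ^ j := by
    intro j hj
    rw [e₆]
    refine BProg.exec_tab_spec (F := fun j => B ^ j) (fun i hi A' h1 h2 => ?_) j hj
    rw [eval_powerExpr (by rw [Function.update_of_ne (by omega), b₅]; omega),
      Function.update_self, Function.update_of_ne (by omega), b₅]
    split_ifs with hi0
    · rw [h2 _ (by omega), ← pow_succ']
      congr 1
      omega
    · rw [not_not.mp hi0, pow_zero]
  have y₇ : σ₇.1 2 = B ^ (2 * (count n fun u => σ₈.2 4 u ≠ 0) + 1) := by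
    rw [e₇, BProg.exec_set_self]
    simp only [eval]
    rw [v₆ 1 (by omega), b₅, p₆ _ (by omega)]
    congr 1
    omega
  have y₈ : σ₈.1 2 = B ^ (2 * (count n fun u => σ₈.2 4 u ≠ 0) + 1) := by
    rw [v₈ 2 (by omega), y₇]
  constructor
  · rw [v₈ 0 (by omega), n₇]
  · rw [a₈, a₇, a₆ 0 (by omega), a₅, a₄ 0 (by omega), a₃ 0 (by omega), a₂ 0 (by omega),
      a₁ 0 (by omega)]
  · rw [a₈, a₇, a₆ 1 (by omega), a₅, a₄ 1 (by omega), a₃ 1 (by omega), a₂ 1 (by omega),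
      a₁ 1 (by omega)]
  · rw [m₈, e₁]
    intro u hu
    -- The greedy rule refers to the partners of smaller vertices, which are the earlier entries of
    -- the same table.
    obtain ⟨A', h1, h2, h3⟩ := BProg.exec_tab_rec N 3 10 matchingExpr σ (i := u) (by omega)
    have hm := fun v => holds_matching (N := N) (A := A') (ρ := Function.update σ.1 10 u)
      (by rw [Function.update_of_ne (by omega)]; omega)
      (by rw [Function.update_self]; omega) v
    rw [Function.update_self, Function.update_of_ne (by omega), h0, h1 0 (by omega)] at hm
    rw [← e₁] at h2 h3
    rw [← e₁]
    have hlt : ∀ {v}, (∀ u' < u, A' 3 u' ≠ u ∧ A' 3 u' ≠ v) ↔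
        ∀ u' < u, σ₁.2 3 u' ≠ u ∧ σ₁.2 3 u' ≠ v :=
      forall₂_congr fun u' hu' => by rw [h2 u' hu']
    constructor
    · intro v hv ha huv hf
      rw [h3]
      exact (find_spec (show v < N by omega)
        ((hm v).mpr ⟨⟨huv, hv⟩, ha, hlt.mpr hf⟩)).1.trans_lt hv
    · intro hM
      have := (hm _).mp (holds_find (h3 ▸ (show σ₁.2 3 u < N by omega)))
      rw [hlt] at this
      change ((u < matchingExpr.eval N A' _ ∧ _) ∧ memAdj n (σ.2 0) u (matchingExpr.eval N A' _) ∧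
        ∀ u' < u, _ ∧ _ ≠ matchingExpr.eval N A' _) at this
      rw [← h3] at this
      exact ⟨this.2.1, this.1.1, this.2.2⟩
  · intro v hv
    rw [m₈, c₈, c₄, ← a₂ 3 (by omega), e₂]
    obtain ⟨A', h1, h2, h3⟩ := BProg.exec_tab_rec N 4 10 coverExpr σ₁ (i := v) (by omega)
    rw [h3, BProg.exec_tab_arr (by omega), ← h1 3 (by omega)]
    refine (holds_coverExpr ?_).trans ?_
    · rw [Function.update_of_ne (by omega)]
      omega
    · rw [Function.update_self, Function.update_of_ne (by omega), n₁]
  · intro v hv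
    have h0' : σ₂.2 0 = σ.2 0 := by rw [a₂ 0 (by omega), a₁ 0 (by omega)]
    have h1' : σ₂.2 1 = σ.2 1 := by rw [a₂ 1 (by omega), a₁ 1 (by omega)]
    rw [show σ₈.2 5 = σ₃.2 5 by rw [a₈, a₇, a₆ 5 (by omega), a₅, a₄ 5 (by omega)], e₃]
    obtain ⟨A', h1, h2, h3⟩ := BProg.exec_tab_rec N 5 10 thresholdExpr σ₂ (i := v) (by omega)
    rw [h3, eval_thresholdExpr, Function.update_self, Function.update_of_ne (by omega), n₂,
      h1 0 (by omega), h1 1 (by omega), h0', h1']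
    · split_ifs with h <;> simp [h]
    · rw [Function.update_of_ne (by omega)]
      omega
  · intro v hv
    rw [show σ₈.2 6 = σ₄.2 6 by rw [a₈, a₇, a₆ 6 (by omega), a₅], c₈, e₄]
    obtain ⟨A', h1, h2, h3⟩ := BProg.exec_tab_rec N 6 10 (cnt 15 10 (.read 4 (.var 15))) σ₃
      (i := v) (by omega)
    rw [h3, eval_cnt (by omega) (by rw [Function.update_self]; omega), Function.update_self,
      BProg.exec_tab_arr (by omega), ← h1 4 (by omega)]
    simp only [holds_read, eval, Function.update_self]
  · exact b₈
  · intro j hj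
    rw [b₈] at hj ⊢
    rw [a₈, a₇, p₆ j (by omega)]
  · rw [b₈, y₈]
  · have : σ₈.1 3 = (n + 2) * σ₇.1 2 := by
      rw [e₈, BProg.exec_set_self, eval_mul (by simp only [eval]; omega)]
      simp only [eval]
      rw [n₇]
    rw [this, v₈ 2 (by omega)]

end TargetSetSelection

/-! ### The second phase: dynamic programming over the states. -/

namespace TargetSetSelection

open RAM RAM.BExpr

/-- Digit `p` of the number in variable `y`, to the base in variable `1`. -/
def digitExpr (y : ℕ) (p : BExpr) : BExpr :=
  .sub (.div (.var y) (.read 7 p))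
    (.mul (.var 1) (.div (.div (.var y) (.read 7 p)) (.var 1)))

def levelExpr (y c : ℕ) : BExpr := digitExpr y (.add (.read 6 (.var c)) (.read 6 (.var c)))

def demandExpr (y c : ℕ) : BExpr :=
  digitExpr y (.add (.add (.read 6 (.var c)) (.read 6 (.var c))) (.const 1))

def sizeExpr (y : ℕ) : BExpr :=
  .div (.var y) (.read 7 (.add (.sub (.var 1) (.const 1)) (.sub (.var 1) (.const 1))))

/-- The layered state space whose states are encoded by numbers, as described by the memory. -/
def memLayers (N n B Y : ℕ) (A : ℕ → ℕ → ℕ) : Layers where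
  n := n
  adj := memAdj n (A 0)
  C v := A 4 v ≠ 0
  T := A 5
  Y := Y
  L y c := bdiv N y (A 7 (A 6 c + A 6 c)) - B * bdiv N (bdiv N y (A 7 (A 6 c + A 6 c))) B
  W y c := bdiv N y (A 7 (A 6 c + A 6 c + 1)) -
    B * bdiv N (bdiv N y (A 7 (A 6 c + A 6 c + 1))) B
  Z y := bdiv N y (A 7 (B - 1 + (B - 1)))

/-- The second phase writes arrays `8`, `9` and `2` only, so the layered state space stays the same
throughout. -/
theorem memLayers_congr {N n B Y : ℕ} {A A' : ℕ → ℕ → ℕ} (h : ∀ b < 8, b ≠ 2 → A' b = A b) :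
    memLayers N n B Y A' = memLayers N n B Y A := by
  simp only [memLayers, h 0 (by omega) (by omega), h 4 (by omega) (by omega),
    h 5 (by omega) (by omega), h 6 (by omega) (by omega), h 7 (by omega) (by omega)]

section Projections

variable (N n B Y : ℕ) (A : ℕ → ℕ → ℕ)

theorem memLayers_n : (memLayers N n B Y A).n = n := rfl

theorem memLayers_adj : (memLayers N n B Y A).adj = memAdj n (A 0) := rfl

theorem memLayers_C (v : ℕ) : (memLayers N n B Y A).C v ↔ A 4 v ≠ 0 := .rfl

theorem memLayers_T : (memLayers N n B Y A).T = A 5 := rfl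

end Projections

def preExpr (y u c : ℕ) : BExpr :=
  le (.read 5 (.var u)) (cnt 17 0 (and (adjExpr u 17)
    (and (.read 4 (.var 17)) (lt (levelExpr y 17) (levelExpr y c)))))

/-- The state in variable `13` is a start state. -/
def startExpr : BExpr :=
  and (eq (sizeExpr 13) (.const 0))
    (all 14 0 (imp (.read 4 (.var 14)) (eq (demandExpr 13 14) (.const 0))))

/-- There is a move from the state in variable `12` to the one in variable `13` when the vertex
in variable `11` is processed. -/
def transExpr : BExpr :=
  and (or (eq (sizeExpr 13) (sizeExpr 12)) (eq (sizeExpr 13) (.add (sizeExpr 12) (.const 1)))) <|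
  and (imp (.read 4 (.var 11)) (imp (eq (levelExpr 13 11) (.const 0))
    (not (eq (sizeExpr 13) (sizeExpr 12))))) <|
  all 14 0 <| imp (.read 4 (.var 14)) <| and (eq (levelExpr 13 14) (levelExpr 12 14)) <|
    or (le (demandExpr 13 14) (demandExpr 12 14)) <|
    and (not (eq (sizeExpr 13) (sizeExpr 12))) <|
    and (le (demandExpr 13 14) (.add (demandExpr 12 14) (.const 1))) <|
    and (not (.read 4 (.var 11))) <| and (adjExpr 14 11) (not (preExpr 13 11 14))

/-- The state in variable `13` is good. -/
def goodExpr : BExpr :=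
  all 14 0 <| imp (.read 4 (.var 14)) <| imp (not (eq (levelExpr 13 14) (.const 0))) <|
    le (.read 5 (.var 14)) <| .add (demandExpr 13 14) <| cnt 15 0 <| and (adjExpr 14 15) <|
      or (and (.read 4 (.var 15)) (lt (levelExpr 13 15) (levelExpr 13 14)))
        (and (not (.read 4 (.var 15))) (preExpr 13 15 14))

/-- Cell `Y * i + y` of array `8` tells whether state `y` can be reached in layer `i`. -/
def reachExpr : BExpr :=
  .letv 11 (.div (.var 10) (.var 2)) <|
  .letv 13 (.sub (.var 10) (.mul (.var 2) (.var 11))) <|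
  .ite (.ite (.var 11)
      (.letv 11 (.sub (.var 11) (.const 1))
        (cnt 12 2 (and (.read 8 (.add (.mul (.var 2) (.var 11)) (.var 12))) transExpr)))
      startExpr)
    (.const 1) (.const 0)

def bestExpr : BExpr :=
  .find 13 (and (lt (.var 13) (.var 2))
    (and (.read 8 (.add (.mul (.var 2) (.var 0)) (.var 13))) goodExpr))

/-- Array `9` is filled with a path to the best state, in reverse order. -/
def traceExpr : BExpr :=
  .ite (.var 10)
    (.letv 11 (.sub (.var 0) (.var 10)) <| .letv 13 (.read 9 (.sub (.var 10) (.const 1))) <|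
      .find 12 (and (lt (.var 12) (.var 2))
        (and (.read 8 (.add (.mul (.var 2) (.var 11)) (.var 12))) transExpr)))
    (.var 4)

def outputExpr : BExpr :=
  or forcedExpr <| .letv 12 (.read 9 (.sub (.var 0) (.var 10))) <|
    .letv 13 (.read 9 (.sub (.sub (.var 0) (.var 10)) (.const 1)))
      (not (eq (sizeExpr 13) (sizeExpr 12)))

/-- The second phase determines the reachable states of all layers, selects the best state in the
last layer, and reads the target set off a path to it. -/
def phaseTwo : BProg :=
  .seq (.tab 8 10 reachExpr) <| .seq (.set 4 bestExpr) <| .seq (.tab 9 10 traceExpr) <|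
  .tab 2 10 outputExpr

section Eval

variable {N : ℕ} {A : ℕ → ℕ → ℕ} {ρ : ℕ → ℕ}

theorem eval_levelExpr (h : ρ 1 ≤ N) (Y y c : ℕ) :
    (levelExpr y c).eval N A ρ = (memLayers N (ρ 0) (ρ 1) Y A).L (ρ y) (ρ c) := by
  rw [levelExpr, digitExpr, eval, eval_mul h]
  rfl

theorem eval_demandExpr (h : ρ 1 ≤ N) (Y y c : ℕ) :
    (demandExpr y c).eval N A ρ = (memLayers N (ρ 0) (ρ 1) Y A).W (ρ y) (ρ c) := by
  rw [demandExpr, digitExpr, eval, eval_mul h]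
  rfl

theorem eval_sizeExpr (Y y : ℕ) :
    (sizeExpr y).eval N A ρ = (memLayers N (ρ 0) (ρ 1) Y A).Z (ρ y) := rfl

theorem holds_preExpr (h : ρ 0 ≤ N) (h' : ρ 1 ≤ N) (Y : ℕ) {y u c : ℕ} (hy : y ≠ 17) (hu : u ≠ 17)
    (hc : c ≠ 17) : (preExpr y u c).Holds N A ρ ↔
      (memLayers N (ρ 0) (ρ 1) Y A).Pre ((memLayers N (ρ 0) (ρ 1) Y A).L (ρ y)) (ρ u)
        ((memLayers N (ρ 0) (ρ 1) Y A).L (ρ y) (ρ c)) := by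
  rw [preExpr, holds_le, eval_cnt (by omega) h]
  simp [holds_and, holds_lt, holds_adjExpr, holds_read, eval, eval_levelExpr _ Y, h, h', hy, hu, hc,
    Function.update_of_ne]
  rfl

theorem holds_startExpr (h : ρ 0 ≤ N) (h' : ρ 1 ≤ N) (Y : ℕ) :
    startExpr.Holds N A ρ ↔ (memLayers N (ρ 0) (ρ 1) Y A).Start (ρ 13) := by
  simp [startExpr, Layers.Start, holds_and, holds_eq, holds_all, holds_imp, holds_read,
    eval_demandExpr _ Y, eval_sizeExpr Y, eval, h, h',
    memLayers_n, memLayers_C]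

theorem holds_transExpr (h : ρ 0 ≤ N) (h' : ρ 1 ≤ N) (Y : ℕ) :
    transExpr.Holds N A ρ ↔ (memLayers N (ρ 0) (ρ 1) Y A).Trans (ρ 11) (ρ 12) (ρ 13) := by
  simp [transExpr, Layers.Trans, holds_and, holds_or, holds_not, holds_le, holds_eq, holds_all,
    holds_imp, holds_read, holds_adjExpr, holds_preExpr _ _ Y,
    eval_demandExpr _ Y, eval_levelExpr _ Y, eval_sizeExpr Y, eval, h, h',
    memLayers_n, memLayers_adj, memLayers_C]

theorem holds_goodExpr (h : ρ 0 ≤ N) (h' : ρ 1 ≤ N) (Y : ℕ) :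
    goodExpr.Holds N A ρ ↔ (memLayers N (ρ 0) (ρ 1) Y A).Good (ρ 13) := by
  simp [goodExpr, Layers.Good, holds_and, holds_or, holds_not, holds_le, holds_lt, holds_eq,
    holds_all, holds_imp, holds_read, holds_adjExpr, holds_preExpr _ _ Y, eval_cnt,
    eval_demandExpr _ Y, eval_levelExpr _ Y, eval, h, h',
    memLayers_n, memLayers_adj, memLayers_C, memLayers_T]

open Classical in
theorem eval_reachExpr (h : ρ 0 ≤ N) (h' : ρ 1 ≤ N) (h2 : ρ 2 ≤ N) : reachExpr.eval N A ρ =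
    if (if bdiv N (ρ 10) (ρ 2) ≠ 0 then
        ∃ y < ρ 2, A 8 (ρ 2 * (bdiv N (ρ 10) (ρ 2) - 1) + y) ≠ 0 ∧
          (memLayers N (ρ 0) (ρ 1) (ρ 2) A).Trans (bdiv N (ρ 10) (ρ 2) - 1) y
            (ρ 10 - ρ 2 * bdiv N (ρ 10) (ρ 2))
      else (memLayers N (ρ 0) (ρ 1) (ρ 2) A).Start (ρ 10 - ρ 2 * bdiv N (ρ 10) (ρ 2)))
    then 1 else 0 := by
  rw [reachExpr, eval_letv, eval_letv, eval_ite_holds]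
  refine if_congr ?_ rfl rfl
  rw [holds_ite]
  simp [holds_var, holds_letv, holds_cnt, holds_and, holds_read, eval_var, eval_const, eval_add, eval_sub,
    eval_div, eval_mul,
    holds_transExpr _ _ (ρ 2), holds_startExpr _ _ (ρ 2), h, h', h2]

theorem holds_best (h : ρ 0 ≤ N) (h' : ρ 1 ≤ N) (h2 : ρ 2 ≤ N) (y : ℕ) :
    (and (lt (.var 13) (.var 2)) (and (.read 8 (.add (.mul (.var 2) (.var 0)) (.var 13)))
      goodExpr)).Holds N A (Function.update ρ 13 y) ↔
    y < ρ 2 ∧ A 8 (ρ 2 * ρ 0 + y) ≠ 0 ∧ (memLayers N (ρ 0) (ρ 1) (ρ 2) A).Good y := by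
  simp [holds_lt, holds_and, holds_read, eval_var, eval_add, eval_mul,
    holds_goodExpr _ _ (ρ 2), h, h', h2]

theorem holds_trace (h : ρ 0 ≤ N) (h' : ρ 1 ≤ N) (h2 : ρ 2 ≤ N) (y : ℕ) :
    (and (lt (.var 12) (.var 2)) (and (.read 8 (.add (.mul (.var 2) (.var 11)) (.var 12)))
      transExpr)).Holds N A (Function.update ρ 12 y) ↔
    y < ρ 2 ∧ A 8 (ρ 2 * ρ 11 + y) ≠ 0 ∧
      (memLayers N (ρ 0) (ρ 1) (ρ 2) A).Trans (ρ 11) y (ρ 13) := by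
  simp [holds_lt, holds_and, holds_read, eval_var, eval_add, eval_mul,
    holds_transExpr _ _ (ρ 2), h, h', h2]

theorem holds_outputExpr (h : ρ 0 ≤ N) (Y : ℕ) : outputExpr.Holds N A ρ ↔
    count (ρ 0) (memAdj (ρ 0) (A 0) (ρ 10)) < A 1 (ρ 10) ∨
      (memLayers N (ρ 0) (ρ 1) Y A).Z (A 9 (ρ 0 - ρ 10 - 1)) ≠
        (memLayers N (ρ 0) (ρ 1) Y A).Z (A 9 (ρ 0 - ρ 10)) := by
  simp [outputExpr, holds_or, holds_forcedExpr, holds_letv, holds_not, holds_eq, eval,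
    eval_sizeExpr Y, h]

end Eval

/-- The bound `(n + 2) * Y ≤ N` accommodates the `n + 1` layers of `Y` cells and the `n + 1` states
of the path. -/
theorem phaseTwo_spec {N n B Y : ℕ} (σ : (ℕ → ℕ) × (ℕ → ℕ → ℕ)) (h0 : σ.1 0 = n)
    (h1 : σ.1 1 = B) (h2 : σ.1 2 = Y) (hY : 0 < Y) (hN : (n + 2) * Y ≤ N) (hB : B ≤ N)
    (hex : ∃ y < Y, (memLayers N n B Y σ.2).Reach n y ∧ (memLayers N n B Y σ.2).Good y) :
    ∃ ys : ℕ → ℕ, (memLayers N n B Y σ.2).Start (ys 0) ∧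
      (∀ i < n, (memLayers N n B Y σ.2).Trans i (ys i) (ys (i + 1))) ∧
      (memLayers N n B Y σ.2).Good (ys n) ∧
      (∀ y < Y, (memLayers N n B Y σ.2).Reach n y → (memLayers N n B Y σ.2).Good y → ys n ≤ y) ∧
      ∀ v < n, (phaseTwo.exec N σ).2 2 v ≠ 0 ↔
        count n (memAdj n (σ.2 0) v) < σ.2 1 v ∨
          (memLayers N n B Y σ.2).Z (ys (v + 1)) ≠ (memLayers N n B Y σ.2).Z (ys v) := by
  classical
  set I := memLayers N n B Y σ.2 with hI
  have hnN : n + 2 ≤ N := le_trans (Nat.le_mul_of_pos_right _ hY) hN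
  have hYN : Y ≤ N := le_trans (Nat.le_mul_of_pos_left _ (by omega)) hN
  have hidx : ∀ i ≤ n, ∀ y < Y, Y * i + y < N := by
    intro i hi y hy
    have : Y * i ≤ Y * n := Nat.mul_le_mul_left _ hi
    nlinarith
  obtain ⟨σ₁, e₁⟩ : ∃ s, s = (BProg.tab 8 10 reachExpr).exec N σ := ⟨_, rfl⟩
  obtain ⟨σ₂, e₂⟩ : ∃ s, s = (BProg.set 4 bestExpr).exec N σ₁ := ⟨_, rfl⟩
  obtain ⟨σ₃, e₃⟩ : ∃ s, s = (BProg.tab 9 10 traceExpr).exec N σ₂ := ⟨_, rfl⟩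
  obtain ⟨σ₄, e₄⟩ : ∃ s, s = (BProg.tab 2 10 outputExpr).exec N σ₃ := ⟨_, rfl⟩
  have e : phaseTwo.exec N σ = σ₄ := by
    rw [e₄, e₃, e₂, e₁]
    rfl
  rw [e]
  have v₁ : ∀ y, y ≠ 10 → σ₁.1 y = σ.1 y := fun y hy => by rw [e₁, BProg.exec_tab_var hy]
  have v₂ : ∀ y, y ≠ 4 → σ₂.1 y = σ₁.1 y := fun y hy => by rw [e₂, BProg.exec_set_var hy]
  have v₃ : ∀ y, y ≠ 10 → σ₃.1 y = σ₂.1 y := fun y hy => by rw [e₃, BProg.exec_tab_var hy]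
  have a₁ : ∀ b, b ≠ 8 → σ₁.2 b = σ.2 b := fun b hb => by rw [e₁, BProg.exec_tab_arr hb]
  have a₂ : σ₂.2 = σ₁.2 := by rw [e₂, BProg.exec_set_arr]
  have a₃ : ∀ b, b ≠ 9 → σ₃.2 b = σ₂.2 b := fun b hb => by rw [e₃, BProg.exec_tab_arr hb]
  have z₁ : ∀ y, y < 3 → σ₁.1 y = σ.1 y := fun y hy => v₁ y (by omega)
  have z₂ : ∀ y, y < 3 → σ₂.1 y = σ.1 y := fun y hy => (v₂ y (by omega)).trans (z₁ y hy)
  have z₃ : ∀ y, y < 3 → σ₃.1 y = σ.1 y := fun y hy => (v₃ y (by omega)).trans (z₂ y hy)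
  have I₁ : memLayers N n B Y σ₁.2 = I := memLayers_congr fun b hb hb' => a₁ b (by omega)
  have I₂ : memLayers N n B Y σ₂.2 = I := by rw [a₂, I₁]
  have I₃ : memLayers N n B Y σ₃.2 = I := by
    rw [← I₂]
    exact memLayers_congr fun b hb hb' => a₃ b (by omega)
  have r₁ : ∀ i ≤ n, ∀ y < Y, σ₁.2 8 (Y * i + y) ≠ 0 ↔ I.Reach i y := by
    -- Layer by layer numbering places all predecessors of a cell at smaller indices, so the table
    -- can be filled by recursion.
    have key : ∀ j < N, σ₁.2 8 j = if I.Reach (j / Y) (j % Y) then 1 else 0 := by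
      intro j hj
      rw [e₁]
      refine BProg.exec_tab_spec
        (F := fun j => if I.Reach (j / Y) (j % Y) then 1 else 0) (fun j hj A' hA hF => ?_) j hj
      have IA : memLayers N n B Y A' = I := memLayers_congr fun b hb hb' => hA b (by omega)
      have hd : bdiv N j Y = j / Y := bdiv_eq hY hj.le
      have hm : j - Y * (j / Y) = j % Y := by
        have := Nat.div_add_mod j Y
        omega
      rw [eval_reachExpr (by simpa using by omega) (by simpa using by omega)
        (by simpa using by omega)]
      have hu : ∀ y < 3, Function.update σ.1 10 j y = σ.1 y :=
        fun y hy => Function.update_of_ne (by omega) _ _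
      simp only [Function.update_self, hu 0 (by omega), hu 1 (by omega), hu 2 (by omega), h0, h1,
        h2, IA, hd, hm]
      refine if_congr ?_ rfl rfl
      rcases Nat.eq_zero_or_pos (j / Y) with hz | hz
      · rw [hz, if_neg (by omega)]
        rfl
      · obtain ⟨i, hi⟩ := Nat.exists_eq_succ_of_ne_zero hz.ne'
        rw [hi, if_pos (by omega), Nat.succ_eq_add_one, Nat.add_sub_cancel, Layers.Reach]
        refine exists_congr fun y => and_congr_right fun (hy : y < Y) => and_congr_left fun _ => ?_
        rw [hF (Y * i + y), Nat.mul_add_div hY, Nat.div_eq_of_lt hy, Nat.mul_add_mod,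
          Nat.mod_eq_of_lt hy, add_zero]
        · simp
        · have := Nat.div_mul_le_self j Y
          rw [hi, Nat.succ_mul, mul_comm] at this
          omega
    intro i hi y hy
    rw [key _ (hidx i hi y hy), Nat.mul_add_div hY, Nat.div_eq_of_lt hy, Nat.mul_add_mod,
      Nat.mod_eq_of_lt hy, add_zero]
    simp
  have best : σ₂.1 4 < Y ∧ I.Reach n (σ₂.1 4) ∧ I.Good (σ₂.1 4) ∧
      ∀ y < Y, I.Reach n y → I.Good y → σ₂.1 4 ≤ y := by
    have hb := fun y => holds_best (N := N) (A := σ₁.2) (ρ := σ₁.1) (y := y)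
      (by rw [z₁ 0 (by omega)]; omega) (by rw [z₁ 1 (by omega)]; omega)
      (by rw [z₁ 2 (by omega)]; omega)
    simp only [z₁ 0 (by omega), z₁ 1 (by omega), z₁ 2 (by omega), h0, h1, h2, I₁] at hb
    have he : σ₂.1 4 = bestExpr.eval N σ₁.2 σ₁.1 := by rw [e₂, BProg.exec_set_self]
    have hle : ∀ y < Y, I.Reach n y → I.Good y → _ := fun y hy hr hg =>
      find_spec (show y < N by omega) ((hb y).mpr ⟨hy, (r₁ n le_rfl y hy).mpr hr, hg⟩)
    obtain ⟨y, hy, hr, hg⟩ := hex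
    have hm := (hb _).mp (hle y hy hr hg).2
    change bestExpr.eval N σ₁.2 σ₁.1 < Y ∧ σ₁.2 8 (Y * n + bestExpr.eval N σ₁.2 σ₁.1) ≠ 0 ∧
      I.Good (bestExpr.eval N σ₁.2 σ₁.1) at hm
    rw [he]
    exact ⟨hm.1, (r₁ n le_rfl _ hm.1).mp hm.2.1, hm.2.2, fun y hy hr hg => (hle y hy hr hg).1⟩
  have t0 : σ₃.2 9 0 = σ₂.1 4 := by
    obtain ⟨A', hA, hF, hE⟩ := BProg.exec_tab_rec N 9 10 traceExpr σ₂ (i := 0) (by omega)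
    rw [e₃, hE, traceExpr, eval_ite_holds, if_neg (by simp [holds_var])]
    simp [eval]
  -- Entry `j` is a state of layer `n - j`. As it is reachable, the search for a reachable
  -- predecessor succeeds.
  have trace : ∀ j, j < n → σ₃.2 9 j < Y → I.Reach (n - j) (σ₃.2 9 j) →
      σ₃.2 9 (j + 1) < Y ∧ I.Reach (n - (j + 1)) (σ₃.2 9 (j + 1)) ∧
        I.Trans (n - (j + 1)) (σ₃.2 9 (j + 1)) (σ₃.2 9 j) := by
    intro j hj hlt hr
    obtain ⟨A', hA, hF, hE⟩ := BProg.exec_tab_rec N 9 10 traceExpr σ₂ (i := j + 1) (by omega)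
    rw [← e₃] at hE hF
    rw [traceExpr, eval_ite_holds, if_pos (by simp [holds_var]), eval_letv, eval_letv] at hE
    have IA : memLayers N n B Y A' = I := by
      rw [← I₂]
      exact memLayers_congr fun b hb hb' => hA b (by omega)
    generalize hρ : Function.update _ 13 _ = ρ at hE
    have ρ0 : ρ 0 = n := by simp [← hρ, z₂, h0]
    have ρ1 : ρ 1 = B := by simp [← hρ, z₂, h1]
    have ρ2 : ρ 2 = Y := by simp [← hρ, z₂, h2]
    have ρ11 : ρ 11 = n - (j + 1) := by simp [← hρ, z₂, h0, eval_sub, eval_var]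
    have ρ13 : ρ 13 = σ₃.2 9 j := by
      simp [← hρ, hF j (by omega), eval_sub, eval_var, eval_read, eval_const]
    have hb := fun y => holds_trace (N := N) (A := A') (ρ := ρ) (y := y) (by omega) (by omega)
      (by omega)
    rw [ρ0, ρ1, ρ2, ρ11, ρ13, IA, hA 8 (by omega), a₂] at hb
    rw [show n - j = n - (j + 1) + 1 by omega] at hr
    obtain ⟨y, hy, hr', ht⟩ : ∃ y < Y, I.Reach (n - (j + 1)) y ∧
      I.Trans (n - (j + 1)) y (σ₃.2 9 j) := hr
    have hm := (hb _).mp (find_spec (show y < N by omega)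
      ((hb y).mpr ⟨hy, (r₁ _ (by omega) y hy).mpr hr', ht⟩)).2
    rw [← hE] at hm
    exact ⟨hm.1, (r₁ _ (by omega) _ hm.1).mp hm.2.1, hm.2.2⟩
  have hall : ∀ j ≤ n, σ₃.2 9 j < Y ∧ I.Reach (n - j) (σ₃.2 9 j) := by
    intro j
    induction j with
    | zero => exact fun _ => by rw [t0]; exact ⟨best.1, best.2.1⟩
    | succ j ih =>
      intro hj
      obtain ⟨h1, h2, -⟩ := trace j hj (ih (by omega)).1 (ih (by omega)).2
      exact ⟨h1, h2⟩
  refine ⟨fun i => σ₃.2 9 (n - i), ?_, fun i hi => ?_, ?_, ?_, fun v hv => ?_⟩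
  · have := (hall n le_rfl).2
    rwa [Nat.sub_self] at this
  · have := (trace (n - (i + 1)) (by omega) (hall _ (by omega)).1 (hall _ (by omega)).2).2.2
    rwa [show n - (i + 1) + 1 = n - i by omega, show n - (n - i) = i by omega] at this
  · simpa [t0] using best.2.2.1
  · simpa [t0] using best.2.2.2
  · obtain ⟨A', hA, hF, hE⟩ := BProg.exec_tab_rec N 2 10 outputExpr σ₃ (i := v) (by omega)
    have IA : memLayers N n B Y A' = I := by
      rw [← I₃]
      exact memLayers_congr fun b hb hb' => hA b hb'
    rw [e₄, hE]
    have ho := holds_outputExpr (N := N) (A := A') (ρ := Function.update σ₃.1 10 v)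
      (by simp [z₃, h0]; omega) Y
    have hu : ∀ y < 3, Function.update σ₃.1 10 v y = σ₃.1 y :=
      fun y hy => Function.update_of_ne (by omega) _ _
    simp only [Function.update_self, hu 0 (by omega), hu 1 (by omega), z₃ 0 (by omega), z₃ 1 (by omega), h0, h1, IA,
      hA 0 (by omega), hA 1 (by omega), hA 9 (by omega), a₃ 0 (by omega), a₃ 1 (by omega), a₂,
      a₁ 0 (by omega), a₁ 1 (by omega)] at ho
    rw [Nat.sub_sub] at ho
    exact ho

end TargetSetSelection

/-! ### Correctness and running time -/

namespace TargetSetSelection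

open RAM Finset

theorem levelling_iff {n : ℕ} {G : SimpleGraph (Fin n)} [DecidableRel G.Adj] {I : Layers}
    (hn : I.n = n) (hadj : ∀ u v : Fin n, I.adj u v ↔ G.Adj u v) {T ℓ : Fin n → ℕ}
    {C S : Finset (Fin n)} {ℓ' : ℕ → ℕ} {S' : ℕ → Prop} (hT : ∀ u, T u = I.T u)
    (hC : ∀ u, u ∈ C ↔ I.C u) (hS : ∀ u, u ∈ S ↔ S' u) (hℓ : ∀ u, ℓ u = ℓ' u) :
    I.Levelling ℓ' S' ↔ IsLevelling G T C S ℓ := by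
  subst hn
  have hcount : ∀ u c : Fin I.n,
      (univ.filter fun v => G.Adj u v ∧ v ∈ C ∧ ℓ v < ℓ c).card =
        count I.n fun v => I.adj u v ∧ I.C v ∧ ℓ' v < ℓ' c := fun u c =>
    card_filter_fin _ _ fun v => by rw [hadj, hC, hℓ, hℓ]
  have hcount' : ∀ c : Fin I.n,
      (univ.filter fun u => G.Adj c u ∧ (u ∈ C ∧ ℓ u < ℓ c ∨
        u ∉ C ∧ (u ∈ S ∨
          T u ≤ (univ.filter fun v => G.Adj u v ∧ v ∈ C ∧ ℓ v < ℓ c).card))).card =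
      count I.n fun u => I.adj c u ∧ (I.C u ∧ ℓ' u < ℓ' c ∨
        ¬ I.C u ∧ (S' u ∨ I.Pre ℓ' u (ℓ' c))) := fun c =>
    card_filter_fin _ _ fun u => by
      rw [hadj, hC, hS, hcount, hT, hℓ, hℓ, Layers.Pre]
  refine and_congr ⟨fun h c hc h0 => ?_, fun h c hc hcC h0 => ?_⟩
    ⟨fun h c hc h0 => ?_, fun h c hc hcC h0 => ?_⟩
  · exact (hS c).mpr (h c c.2 ((hC c).mp hc) (by rw [← hℓ, h0]))
  · exact (hS ⟨c, hc⟩).mp (h _ ((hC ⟨c, hc⟩).mpr hcC) ((hℓ ⟨c, hc⟩).trans h0))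
  · rw [hcount', hT]
    exact h c c.2 ((hC c).mp hc) (by rwa [← hℓ])
  · have := h ⟨c, hc⟩ ((hC ⟨c, hc⟩).mpr hcC) (by rwa [hℓ])
    rwa [hcount', hT] at this

theorem memAdj_inputState {n : ℕ} (G : SimpleGraph (Fin n)) [DecidableRel G.Adj] (τ : Fin n → ℕ)
    (u v : Fin n) : memAdj n ((inputState G τ).arr 0) u v ↔ G.Adj u v := by
  simp only [memAdj, inputState, if_true]
  constructor
  · intro h
    split_ifs at h with h'
    · obtain ⟨u', v', he, ha⟩ := h'
      have hn : 0 < n := u.pos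
      have h1 := congrArg (· / n) he
      have h2 := congrArg (· % n) he
      simp only [mul_comm _ n, Nat.mul_add_div hn, Nat.mul_add_mod, Nat.div_eq_of_lt v.2,
        Nat.div_eq_of_lt v'.2, Nat.mod_eq_of_lt v.2, Nat.mod_eq_of_lt v'.2, add_zero] at h1 h2
      rwa [Fin.ext h1, Fin.ext h2]
    · exact absurd rfl h
  · intro h
    rw [if_pos ⟨u, v, by rw [mul_comm], h⟩]
    exact one_ne_zero

section Correctness

variable {n : ℕ} {G : SimpleGraph (Fin n)} [DecidableRel G.Adj] {τ : Fin n → ℕ} {ρ : ℕ → ℕ}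
  {A : ℕ → ℕ → ℕ}

/-- The program never learns `t`; a minimum cover serves only as the set to which the matching is
compared. -/
theorem PhaseOneSpec.count_cover_le (h : PhaseOneSpec n (inputState G τ).arr ρ A) {t : ℕ}
    (ht : G.vertexCoverNum = (t : ℕ∞)) : (count n fun v => A 4 v ≠ 0) ≤ 2 * t := by
  classical
  obtain ⟨K, hK, hcov⟩ := SimpleGraph.vertexCoverNum_exists G
  rw [ht] at hK
  have hcard : (count n fun v => ∃ h : v < n, (⟨v, h⟩ : Fin n) ∈ K) = t := by
    rw [← card_filter_fin (fun v : Fin n => v ∈ K) _ fun v => by simp]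
    rw [← Set.coe_toFinset K, Set.encard_coe_eq_coe_finsetCard] at hK
    have : (univ.filter fun v : Fin n => v ∈ K) = K.toFinset := by
      ext v
      simp
    rw [this]
    exact_mod_cast hK
  rw [count_congr h.cover, ← hcard]
  refine h.greedy.count_le fun u hu v hv ha => ?_
  rcases hcov ((memAdj_inputState G τ ⟨u, hu⟩ ⟨v, hv⟩).mp ha) with h | h
  · exact .inl ⟨hu, h⟩
  · exact .inr ⟨hv, h⟩

/-- The second phase, started in the memory that the first phase leaves, finds an optimal target
set. -/
theorem PhaseOneSpec.isOptimalTargetSet (h : PhaseOneSpec n (inputState G τ).arr ρ A) :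
    IsOptimalTargetSet G τ
      (univ.filter fun v : Fin n => (phaseTwo.exec (ρ 3) (ρ, A)).2 2 v ≠ 0) := by
  classical
  set k := count n fun u => A 4 u ≠ 0 with hk
  set I := memLayers (ρ 3) n (k + 1) ((k + 1) ^ (2 * k + 1)) A with hI
  have hY : 0 < (k + 1) ^ (2 * k + 1) := Nat.pow_pos (Nat.succ_pos k)
  have h1 : ρ 1 = k + 1 := h.base
  have h2 : ρ 2 = (k + 1) ^ (2 * k + 1) := by rw [h.states, h1]
  have h3 : (n + 2) * (k + 1) ^ (2 * k + 1) = ρ 3 := by rw [h.bound, h2]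
  have hYN : (k + 1) ^ (2 * k + 1) ≤ ρ 3 := h3 ▸ Nat.le_mul_of_pos_left _ (by omega)
  have hBN : k + 1 ≤ ρ 3 := le_trans (Nat.le_self_pow (by omega) _) hYN
  have hpow : ∀ j < 2 * (k + 1), A 7 j = (k + 1) ^ j := by
    have := h.power
    rwa [h1] at this
  have hdigit : ∀ y < (k + 1) ^ (2 * k + 1), ∀ j < 2 * (k + 1),
      BExpr.bdiv (ρ 3) y (A 7 j) = y / (k + 1) ^ j := fun y hy j hj => by
    rw [hpow j hj, BExpr.bdiv_eq (Nat.pow_pos (Nat.succ_pos k)) (by omega)]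
  have hmod : ∀ y < (k + 1) ^ (2 * k + 1), ∀ j < 2 * (k + 1),
      BExpr.bdiv (ρ 3) y (A 7 j) - (k + 1) * BExpr.bdiv (ρ 3) (BExpr.bdiv (ρ 3) y (A 7 j)) (k + 1)
        = y / (k + 1) ^ j % (k + 1) := fun y hy j hj => by
    rw [hdigit y hy j hj, BExpr.bdiv_eq (show 0 < k + 1 by omega)
      ((Nat.div_le_self _ _).trans (by omega))]
    have := Nat.div_add_mod (y / (k + 1) ^ j) (k + 1)
    omega
  have hidx : ∀ c < n, A 4 c ≠ 0 → A 6 c = count c (fun u => A 4 u ≠ 0) ∧ A 6 c < k := by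
    intro c hc hcC
    refine ⟨h.index c hc, ?_⟩
    rw [h.index c hc]
    have := count_mono (Nat.succ_le_of_lt hc) fun u => A 4 u ≠ 0
    rw [Nat.succ_eq_add_one, count_succ, if_pos hcC] at this
    omega
  have hZ : ∀ y < (k + 1) ^ (2 * k + 1), I.Z y = y / (k + 1) ^ (2 * k) := by
    intro y hy
    have := hdigit y hy (k + 1 - 1 + (k + 1 - 1)) (by omega)
    exact this.trans (by rw [show k + 1 - 1 + (k + 1 - 1) = 2 * k by omega])
  -- The size is the leading digit, so minimizing the code minimizes the size.
  have hZmono : ∀ y y', y ≤ y' → y' < (k + 1) ^ (2 * k + 1) → I.Z y ≤ I.Z y' := by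
    intro y y' hle hy'
    rw [hZ y (by omega), hZ y' hy']
    exact Nat.div_le_div_right hle
  have henc : ∀ (ℓ w : ℕ → ℕ) (z : ℕ), (∀ c, ℓ c < k + 1) → (∀ c, w c < k + 1) → z < k + 1 →
      ∃ y < I.Y, I.Z y = z ∧ ∀ c < I.n, I.C c → I.L y c = ℓ c ∧ I.W y c = w c := by
    intro ℓ w z hℓ hw hz
    obtain ⟨y, hy, hyz, hd⟩ := exists_state hk ℓ w z hℓ hw hz
    refine ⟨y, hy, (hZ y hy).trans hyz, fun c hc hcC => ?_⟩
    obtain ⟨hc1, hc2⟩ := hidx c hc hcC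
    obtain ⟨hd1, hd2⟩ := hd c hc hcC
    rw [← hc1] at hd1 hd2
    rw [← hd1, ← hd2, two_mul]
    exact ⟨hmod y hy _ (by omega), hmod y hy _ (by omega)⟩
  let C : Finset (Fin n) := univ.filter fun v => A 4 v ≠ 0
  have hCard : C.card = k := card_filter_fin _ _ fun v => .rfl
  have hCmem : ∀ u, u ∈ C ↔ I.C u := fun u => by simp [C, hI, memLayers]
  let T : Fin n → ℕ := fun u => A 5 u
  have hadj : ∀ u v : Fin n, memAdj n (A 0) u v ↔ G.Adj u v := fun u v => by
    rw [h.arr_zero, memAdj_inputState]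
  have hdeg : ∀ u : Fin n, (univ.filter fun v => G.Adj u v).card = count n (memAdj n (A 0) u) :=
    fun u => card_filter_fin _ _ fun v => (hadj u v).symm
  have hτ : ∀ u : Fin n, (inputState G τ).arr 1 u = τ u := fun u => by simp [inputState]
  have hT : ∀ u, T u = if (univ.filter fun v => G.Adj u v).card < τ u then 0 else τ u := by
    intro u
    have := h.threshold u u.2
    rw [hdeg, h.arr_zero]
    rw [hτ] at this
    rcases this with ⟨h1, h2⟩ | ⟨h1, h2⟩
    · rw [if_pos h1]
      exact h2
    · rw [if_neg h1]
      exact h2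
  have hTle : ∀ u, T u ≤ (univ.filter fun v => G.Adj u v).card := by
    intro u
    rw [hT]
    split_ifs <;> omega
  have hcov : ∀ u v, G.Adj u v → u ∈ C ∨ v ∈ C := by
    intro u v huv
    have key : ∀ u v : Fin n, u < v → G.Adj u v → u ∈ C ∨ v ∈ C := by
      intro u v hlt ha
      simp only [C, mem_filter, mem_univ, true_and, h.cover u u.2, h.cover v v.2]
      exact h.greedy.cover hlt v.2 ((memAdj_inputState G τ u v).mpr ha)
    rcases lt_trichotomy u v with hlt | heq | hlt
    · exact key u v hlt huv
    · exact absurd heq huv.ne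
    · exact (key v u hlt huv.symm).symm
  -- Selecting all of `C` at level `0` is a levelling. This makes the final search succeed and
  -- bounds the size found by `k`.
  have hCreach := Layers.exists_reach (I := I) (B := k + 1) henc (ℓ := fun _ => 0)
    (S := fun v => A 4 v ≠ 0) ⟨fun c _ hc _ => hc, fun c _ _ hc => absurd rfl hc⟩
    (fun _ => Nat.succ_pos k) (Nat.lt_succ_self k)
  obtain ⟨yC, hyC, hrC, hgC, hzC⟩ := hCreach
  obtain ⟨ys, hstart, htrans, hgood, hbest, hout⟩ := phaseTwo_spec (N := ρ 3) (ρ, A)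
    h.var_zero h1 h2 hY h3.le hBN ⟨yC, hyC, hrC, hgC⟩
  obtain ⟨hlev, hcount⟩ := Layers.levelling_of_path (I := I) hstart htrans hgood
  let S : Finset (Fin n) := univ.filter fun v => I.Z (ys (v + 1)) ≠ I.Z (ys v)
  have hScard : S.card = I.Z (ys n) := (card_filter_fin _ _ fun v => .rfl).trans hcount
  have hSk : S.card ≤ k := by
    rw [hScard]
    exact (hZmono _ _ (hbest yC hyC hrC hgC) hyC).trans hzC.le
  refine isOptimalTargetSet_of_forced hT (S := S) ⟨?_, fun R hR => ?_⟩ fun u => ?_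
  · refine IsLevelling.isTargetSet (C := C) (ℓ := fun c => I.L (ys n) c) hcov hTle ?_
    exact (levelling_iff (G := G) (I := I) (T := T) (C := C) (S := S)
      (ℓ := fun c => I.L (ys n) c) rfl hadj (fun _ => rfl) hCmem (fun u => by simp [S])
      (fun _ => rfl)).mp hlev
  -- Larger competitors lose against the bound `k`; smaller ones fit into the digits and hence give
  -- a good reachable state.
  · by_cases hRk : R.card ≤ k
    · obtain ⟨ℓ, hℓ, hlevR⟩ := exists_isLevelling hcov hR
      rw [hCard] at hℓ
      have hRcount : R.card = count n fun v => ∃ hv : v < n, (⟨v, hv⟩ : Fin n) ∈ R := by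
        rw [← card_filter_fin (fun v : Fin n => v ∈ R) _ fun v => by simp]
        congr 1
        ext v
        simp
      obtain ⟨y, hy, hr, hg, hz⟩ := Layers.exists_reach (I := I) (B := k + 1) henc
        (ℓ := fun c => if hc : c < n then ℓ ⟨c, hc⟩ else 0)
        (S := fun v => ∃ hv : v < n, (⟨v, hv⟩ : Fin n) ∈ R)
        ((levelling_iff (G := G) (I := I) (T := T) (C := C) (S := R) (ℓ := ℓ) rfl hadj
          (fun _ => rfl) hCmem (fun u => by simp) (fun u => by simp)).mpr hlevR)
        (fun c => by
          split_ifs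
          exacts [Nat.lt_succ_of_le (hℓ _), Nat.succ_pos k])
        (show count n _ < _ by rw [← hRcount]; omega)
      rw [hScard, hRcount]
      exact (hZmono _ _ (hbest y hy hr hg) hy).trans hz.le
    · omega
  · simp only [mem_filter, mem_univ, true_and, S]
    rw [hout u u.2, hdeg]
    change count n (memAdj n (A 0) u) < A 1 u ∨ I.Z (ys (u + 1)) ≠ I.Z (ys u) ↔ _
    rw [h.arr_one, hτ]

end Correctness

/-- For `t ≥ 2` both `2t + 1 ≤ t ^ 3` and `3(4t + 1) ≤ 15t` hold, and `t ^ (15t)` is the power of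
`2` on the right. For `t ≤ 1` that power is `1`, whence the factor `243 = 3 ^ 5`. -/
theorem pow_le_rpow_mul_log (t : ℕ) :
    ((2 * t + 1 : ℕ) : ℝ) ^ (4 * t + 1) ≤
      243 * (2 : ℝ) ^ (15 * ((t : ℝ) * Real.logb 2 (t : ℝ))) := by
  rcases Nat.lt_or_ge t 2 with ht | ht
  · interval_cases t <;> norm_num
  · have h1 : (2 : ℝ) ^ (15 * ((t : ℝ) * Real.logb 2 (t : ℝ))) = (t : ℝ) ^ (15 * t) := by
      rw [show 15 * ((t : ℝ) * Real.logb 2 (t : ℝ)) =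
        Real.logb 2 (t : ℝ) * ((15 * t : ℕ) : ℝ) by push_cast; ring,
        Real.rpow_mul (by norm_num), Real.rpow_natCast,
        Real.rpow_logb (by norm_num) (by norm_num) (by positivity)]
    rw [h1]
    have h2 : (2 * t + 1) ^ (4 * t + 1) ≤ t ^ (15 * t) := by
      calc (2 * t + 1) ^ (4 * t + 1) ≤ (t ^ 3) ^ (4 * t + 1) :=
            Nat.pow_le_pow_left (by nlinarith [Nat.mul_le_mul ht ht]) _
        _ = t ^ (3 * (4 * t + 1)) := by rw [pow_mul]
        _ ≤ t ^ (15 * t) := Nat.pow_le_pow_right (by omega) (by omega)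
    have h3 : ((2 * t + 1 : ℕ) : ℝ) ^ (4 * t + 1) ≤ (t : ℝ) ^ (15 * t) := by exact_mod_cast h2
    have h4 : (0 : ℝ) ≤ (t : ℝ) ^ (15 * t) := by positivity
    linarith

/-- The program that computes an optimal target set. -/
def targetSetProg : Prog :=
  .seq (.set 1 (.add (.add (.reg 0) (.reg 0)) (.const 2))) <|
  .seq phaseOne.compile <| .seq (.set 1 (.reg 6)) phaseTwo.compile

theorem exists_runs_targetSetProg : ∃ D : ℕ, ∀ (n : ℕ) (G : SimpleGraph (Fin n))
    [DecidableRel G.Adj] (τ : Fin n → ℕ) (t : ℕ), G.vertexCoverNum = (t : ℕ∞) →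
    ∃ k s, Runs targetSetProg (inputState G τ) k s ∧ IsOptimalTargetSet G τ (outputSet n s) ∧
      k ≤ ((n + 2) * (2 * t + 1) ^ (4 * t + 1) + 2) ^ D := by
  obtain ⟨d₁, hd₁⟩ := phaseOne.exists_runs_compile
  obtain ⟨d₂, hd₂⟩ := phaseTwo.exists_runs_compile
  refine ⟨6 + (2 * d₁ + (2 + d₂ + 1) + 1) + 1, fun n G _ τ t ht => ?_⟩
  set s₀ := inputState G τ with hs₀
  have r₀ : s₀.reg 0 = n := by simp [hs₀, inputState]
  obtain ⟨k₁, s₁, hr₁, hk₁, hb₁, he₁⟩ := hd₁ (s₀.setReg 1 (n + n + 2))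
  have hspec := phaseOne_spec (n := n) ((s₀.setReg 1 (n + n + 2)).vars, s₀.arr)
    (by simp [State.vars, r₀])
  have hreg : (s₀.setReg 1 (n + n + 2)).reg 1 = 2 * n + 2 := by
    rw [State.setReg_reg, if_pos rfl]
    ring
  rw [hreg, State.setReg_arr] at he₁
  rw [← he₁] at hspec
  change PhaseOneSpec n s₀.arr s₁.vars s₁.arr at hspec
  -- Register `6` is variable `3`, the bound prepared for the second phase.
  obtain ⟨k₂, s₂, hr₂, hk₂, hb₂, he₂⟩ := hd₂ (s₁.setReg 1 (s₁.reg 6))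
  have hv : (s₁.setReg 1 (s₁.reg 6)).vars = s₁.vars := by
    funext x
    rw [State.vars, State.setReg_reg, if_neg (by omega), State.vars]
  have hreg' : (s₁.setReg 1 (s₁.reg 6)).reg 1 = s₁.vars 3 := by
    rw [State.setReg_reg, if_pos rfl, State.vars]
  rw [hv, hreg', State.setReg_arr] at he₂
  have hset : Runs (.set 1 (.add (.add (.reg 0) (.reg 0)) (.const 2))) s₀ 6
      (s₀.setReg 1 (n + n + 2)) := by
    have := Runs.set 1 (.add (.add (.reg 0) (.reg 0)) (.const 2)) s₀
    simpa only [Expr.eval, Expr.cost, r₀] using this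
  refine ⟨_, _, .seq hset (.seq hr₁ (.seq (.set _ _ _) hr₂)), ?_, ?_⟩
  · have h := hspec.isOptimalTargetSet
    rw [← he₂] at h
    exact h
  · have hB := hspec.base
    have hY := hspec.states
    have hN := hspec.bound
    have hcov := hspec.count_cover_le ht
    rw [hB] at hY
    -- Here `k ≤ 2t` bounds both the base `k + 1` and the exponent `2k + 1`.
    have hYt : s₁.vars 2 ≤ (2 * t + 1) ^ (4 * t + 1) := by
      rw [hY]
      exact (Nat.pow_le_pow_left (by omega) _).trans
        (Nat.pow_le_pow_right (by omega) (by omega))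
    have hQ : s₁.vars 3 + 2 ≤ (n + 2) * (2 * t + 1) ^ (4 * t + 1) + 2 := by
      rw [hN]
      exact Nat.add_le_add_right (Nat.mul_le_mul_left _ hYt) 2
    rw [hreg'] at hk₂
    rw [hreg] at hk₁
    have hP : 1 ≤ (2 * t + 1) ^ (4 * t + 1) := Nat.one_le_pow _ _ (by omega)
    set P := (2 * t + 1) ^ (4 * t + 1)
    have hQ2 : 2 ≤ (n + 2) * P + 2 := by omega
    refine cost_add hQ2 (cost_const hQ2 6) (cost_add hQ2 ?_ (cost_add hQ2 (cost_const hQ2 2) ?_))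
    -- The first phase is bounded in terms of `2n + 4`, which is at most the square of the common
    -- base; hence the exponent `2 * d₁`.
    · rw [pow_mul]
      refine hk₁.trans (Nat.pow_le_pow_left ?_ _)
      nlinarith
    · exact hk₂.trans (Nat.pow_le_pow_left hQ _)

end TargetSetSelection

theorem theorem3 :
    ∃ (P : RAM.Prog) (C c d : ℕ),
      ∀ (n : ℕ) (G : SimpleGraph (Fin n)) [DecidableRel G.Adj] (τ : Fin n → ℕ) (t : ℕ),
        G.vertexCoverNum = (t : ℕ∞) →
        ∃ (k : ℕ) (s : RAM.State),
          RAM.Runs P (TargetSetSelection.inputState G τ) k s ∧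
          TargetSetSelection.IsOptimalTargetSet G τ (TargetSetSelection.outputSet n s) ∧
          (k : ℝ) ≤ C * (2 : ℝ) ^ ((c : ℝ) * ((t : ℝ) * Real.logb 2 (t : ℝ))) *
            ((n : ℝ) + 1) ^ d := by
  obtain ⟨D, hD⟩ := TargetSetSelection.exists_runs_targetSetProg
  -- The constant is `972 = 4 * 243`: the `4` comes from `h1`, and `243` from `pow_le_rpow_mul_log`.
  refine ⟨TargetSetSelection.targetSetProg, 972 ^ D, 15 * D, D, fun n G _ τ t ht => ?_⟩
  obtain ⟨k, s, hr, ho, hk⟩ := hD n G τ t ht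
  refine ⟨k, s, hr, ho, ?_⟩
  have hP : 1 ≤ (2 * t + 1) ^ (4 * t + 1) := Nat.one_le_pow _ _ (by omega)
  have h1 : (n + 2) * (2 * t + 1) ^ (4 * t + 1) + 2 ≤ 4 * (2 * t + 1) ^ (4 * t + 1) * (n + 1) := by
    nlinarith
  have h2 := hk.trans (Nat.pow_le_pow_left h1 D)
  have h3 := TargetSetSelection.pow_le_rpow_mul_log t
  calc (k : ℝ) ≤ (4 * ((2 * t + 1 : ℕ) : ℝ) ^ (4 * t + 1) * ((n : ℝ) + 1)) ^ D := by
        exact_mod_cast h2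
    _ ≤ (4 * (243 * (2 : ℝ) ^ (15 * ((t : ℝ) * Real.logb 2 (t : ℝ)))) * ((n : ℝ) + 1)) ^ D := by
        gcongr
    _ = _ := by
        rw [mul_pow, ← mul_assoc, mul_pow, ← Real.rpow_mul_natCast (by norm_num)]
        push_cast
        ring_nf
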